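/- For a full-rank lattice $\Lambda\subset\mathbb R^2$ let $S(\Lambda)$ be the set of its nonzero vectors of minimal Euclidean norm; $\Lambda$ is well-rounded if $S(\Lambda)$ spans $\mathbb R^2$. For a positive integer $u$ let $\mathcal N(u)$ be the number of full-rank well-rounded sublattices $\Lambda\subseteq\mathbb Z^2$ with determinant (covolume) $u$, and let $\mathcal D$ be the set of determinants of full-rank well-rounded sublattices of $\mathbb Z^2$. Let $\tau(u)$ and $\omega(u)$ be the numbers of positive divisors and of distinct prime divisors of $u$. Then the following hold. (1) $\mathcal N(u)$ is finite for every $u\ge 1$, and there are absolute constants $C_1,C_2$ such that for all integers $u\ge1$ $$\mathcal N(u)\le C_1\,\tau(u)^2\,2^{\omega(u)}\qquad\text{and}\qquad \tau(u)^2\,2^{\omega(u)}\le C_2\left(\frac{\sqrt2\,\log u}{\omega(u)}\right)^{2\omega(u)},$$ where for $u=1$ (so that $\omega(u)=0$) the last power is read as $1$. (2) There are a set $E\subseteq\mathcal D$ of asymptotic density $0$, that is $\lim_{M\to\infty}|\{n\in E: n\le M\}|/M=0$, and a constant $C$ such that $\mathcal N(u)< C(\log u)^{\log 8}$ for all $u\in\mathcal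 D\setminus E$. (3) There are a strictly increasing sequence $(u_k)_{k\ge1}$ of elements of $\mathcal D$, each of which is a product $\prod_{p\in S}p^2$ over a finite nonempty set $S$ of (distinct) primes $p\equiv1\pmod 4$, and a constant $C$ such that $$\mathcal N(u_k)\ge(\log u_k)^k\quad\text{for all }k\ge1,$$ and $u_k\le\exp\left(C\,k(\log k)^2\right)$ and $\omega(u_k)\le C\,k\log k$ for all $k\ge2$. -/

import Mathlib

open Filter Topology

noncomputable section

/-- The Euclidean plane `ℝ²`, with its Euclidean norm. -/
abbrev Plane : Type := EuclideanSpace ℝ (Fin 2)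

/-- The integer lattice `ℤ²` in the Euclidean plane. -/
def integerLattice : Submodule ℤ Plane :=
  Submodule.span ℤ (Set.range (EuclideanSpace.basisFun (Fin 2) ℝ))

/-- The set `S(Λ)` of minimal vectors of `Λ`: the nonzero vectors of `Λ` of least Euclidean norm. -/
def minimalVectors (L : Submodule ℤ Plane) : Set Plane :=
  {x | x ∈ L ∧ x ≠ 0 ∧ ∀ y ∈ L, y ≠ 0 → ‖x‖ ≤ ‖y‖}

/-- A lattice in the plane is well-rounded if its minimal vectors span `ℝ²` over `ℝ`. -/
def IsWellRounded (L : Submodule ℤ Plane) : Prop :=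
  Submodule.span ℝ (minimalVectors L) = ⊤

/-- `WR(Ω)`: the full-rank well-rounded sublattices of a lattice `Ω`. -/
def WR (M : Submodule ℤ Plane) : Set (Submodule ℤ Plane) :=
  {L | L ≤ M ∧ Submodule.span ℝ (L : Set Plane) = ⊤ ∧ IsWellRounded L}

/-- The lattices in `WR(ℤ²)` whose determinant (covolume) equals `u`. -/
def wrLatticesOfDet (u : ℕ) : Set (Submodule ℤ Plane) :=
  {L | L ∈ WR integerLattice ∧ ZLattice.covolume L = (u : ℝ)}

/-- `𝒩(u)`: the number of lattices in `WR(ℤ²)` with determinant `u`. -/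
def wrCount (u : ℕ) : ℕ := (wrLatticesOfDet u).ncard

/-- `𝒟`: the set of determinants of lattices in `WR(ℤ²)`. -/
def determinantSet : Set ℕ := {u | (wrLatticesOfDet u).Nonempty}

/-- The number `τ(u)` of positive divisors of `u`. -/
def numDivisors (u : ℕ) : ℕ := u.divisors.card

/-- The set `P` has asymptotic density `δ`: `|{n ∈ P : n ≤ M}| / M → δ` as `M → ∞`. -/
def HasAsymptoticDensity (P : Set ℕ) (δ : ℝ) : Prop :=
  Tendsto (fun M : ℕ => (({n | n ∈ P ∧ n ≤ M} : Set ℕ).ncard : ℝ) / (M : ℝ)) atTop (𝓝 δ)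

end

/-! Upper bound. A well-rounded lattice is generated by two minimal vectors `x`, `y` of equal
length, so `x + y` and `x - y` are orthogonal. Hence `x + y = g z` with `z` primitive, `x - y = n i
z`, and `2u = g |n| |z|²`. The lattice is therefore determined by `r = |z|²`, `z`, `g` and the sign
of `n`. There are at most `4 * 2 ^ ω(r)` choices of `z`, and the identity `∑_{d ∣ n} 2 ^ ω(d) τ(n /
d) = τ(n)²` with `n = 2u` gives `𝒩(u) ≤ 8 τ(2u)² ≤ 32 τ(u)²` (`wrCount_le`). This is stronger than
(1) asks. The comparison of `τ` with `log u / ω` is AM-GM over the prime factors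
(`numDivisors_le_log_div_pow`).

Density. If `𝒩(u) ≥ 32 (log u) ^ log 8`, then `τ(u) ≥ (log u) ^ (log 8 / 2)`. Since `log 8 / 2 > 1`
while the mean of `τ` up to `M` is at most `1 + log M`, Markov's inequality makes such `u` rare.

Large values. If `u` is the product of the squares of `t` primes `p ≡ 1 (mod 4)`, choosing `π_p²` or
its conjugate for each `p = |π_p|²` gives `2 ^ t` distinct square lattices of determinant `u`
(`two_pow_card_le_wrCount`). Taking the first `t ≍ k log k` such primes makes `2 ^ t ≥ (log u) ^ k`,
because `log u = O(t log t)`. The latter needs only a polynomial bound for the `t`-th such prime,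
obtained by Chebyshev's method from `∏ (4n² + 1)` (`four_pow_le_pow_count`). -/

/-! ### Counting primitive representations as a sum of two squares -/

/-- The primitive integer vectors of squared norm `r`. -/
noncomputable def primitiveReps (r : ℕ) : Finset (ℤ × ℤ) :=
  (Finset.Icc (-(r : ℤ)) r ×ˢ Finset.Icc (-(r : ℤ)) r).filter
    fun z => Int.gcd z.1 z.2 = 1 ∧ z.1 ^ 2 + z.2 ^ 2 = r

theorem abs_le_of_sq_add_sq_eq {a b : ℤ} {r : ℕ} (h : a ^ 2 + b ^ 2 = r) : -(r : ℤ) ≤ a ∧ a ≤ r := by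
  have h1 : |a| ≤ a ^ 2 := by
    rw [← sq_abs]
    rcases (abs_nonneg a).eq_or_lt with h0 | h0
    · rw [← h0]; norm_num
    · nlinarith
  have h2 := sq_nonneg b
  exact abs_le.mp (by linarith)

theorem mem_primitiveReps {r : ℕ} {z : ℤ × ℤ} :
    z ∈ primitiveReps r ↔ Int.gcd z.1 z.2 = 1 ∧ z.1 ^ 2 + z.2 ^ 2 = r := by
  unfold primitiveReps
  simp only [Finset.mem_filter, Finset.mem_product, Finset.mem_Icc, and_iff_right_iff_imp]
  rintro ⟨-, h⟩
  exact ⟨abs_le_of_sq_add_sq_eq h, abs_le_of_sq_add_sq_eq (by rw [add_comm]; exact h)⟩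

/-- Vectors of the same squared norm `r` whose determinant is divisible by `r` differ by a
quarter-turn rotation. -/
theorem eq_unit_mul_of_dvd_det {a b c d r : ℤ} (hr : 0 < r) (h1 : a ^ 2 + b ^ 2 = r)
    (h2 : c ^ 2 + d ^ 2 = r) (h : r ∣ a * d - b * c) :
    (a = c ∧ b = d) ∨ (a = -c ∧ b = -d) ∨ (a = d ∧ b = -c) ∨ (a = -d ∧ b = c) := by
  obtain ⟨k, hk⟩ := h
  -- Lagrange's identity: determinant squared plus inner product squared is `r²`. So `|k| ≤ 1`, and
  -- equality in Cauchy–Schwarz (`k = 0`) or orthogonality (`k = ±1`) fixes the vector.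
  have hS : (r * k) ^ 2 + (a * c + b * d) ^ 2 = r ^ 2 := by
    rw [← hk, sq r]; nth_rewrite 1 [← h1]; rw [← h2]; ring
  have hk2 : k ^ 2 ≤ 1 := by
    have : r ^ 2 * k ^ 2 ≤ r ^ 2 * 1 := by nlinarith [sq_nonneg (a * c + b * d)]
    exact le_of_mul_le_mul_left this (by positivity)
  have hk3 : -1 ≤ k ∧ k ≤ 1 := ⟨by nlinarith, by nlinarith⟩
  have key : ∀ x y : ℤ, x ^ 2 + y ^ 2 = 0 → x = 0 ∧ y = 0 := fun x y h =>
    ⟨by nlinarith [sq_nonneg x, sq_nonneg y, pow_eq_zero_iff (M₀ := ℤ) (a := x) two_ne_zero],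
      by nlinarith [sq_nonneg x, sq_nonneg y, pow_eq_zero_iff (M₀ := ℤ) (a := y) two_ne_zero]⟩
  obtain rfl | rfl | rfl : k = -1 ∨ k = 0 ∨ k = 1 := by omega
  · obtain ⟨h3, h4⟩ := key (a + d) (b - c) (by linarith [hk])
    right; right; right; constructor <;> linarith
  · have : (a * c + b * d - r) * (a * c + b * d + r) = 0 := by nlinarith
    rcases mul_eq_zero.mp this with h0 | h0
    · obtain ⟨h3, h4⟩ := key (a - c) (b - d) (by linarith)
      left; constructor <;> linarith
    · obtain ⟨h3, h4⟩ := key (a + c) (b + d) (by linarith)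
      right; left; constructor <;> linarith
  · obtain ⟨h3, h4⟩ := key (a - d) (b + c) (by linarith [hk])
    right; right; left; constructor <;> linarith

theorem not_dvd_of_gcd_eq_one {p a b r : ℤ} (hp : Prime p) (hg : Int.gcd a b = 1)
    (h : a ^ 2 + b ^ 2 = r) (hpr : p ∣ r) : ¬ p ∣ a ∧ ¬ p ∣ b := by
  have aux : p ∣ a → p ∣ b → False := fun ha hb => by
    have := Int.dvd_coe_gcd ha hb
    rw [hg] at this
    exact hp.not_isUnit (isUnit_of_dvd_one (by simpa using this))
  rw [← h] at hpr
  constructor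
  · intro ha
    exact aux ha (hp.dvd_of_dvd_pow ((dvd_add_right (dvd_pow ha two_ne_zero)).mp hpr))
  · intro hb
    exact aux (hp.dvd_of_dvd_pow ((dvd_add_left (dvd_pow hb two_ne_zero)).mp hpr)) hb

/-- The product of `ad - cb` and `ad + cb` is `r (a² - c²)`. An odd prime dividing both factors
would divide `2ad`, contradicting primitivity, so the full power of `p` falls into a single factor.
-/
theorem odd_pow_dvd_or {p : ℕ} (hp : p.Prime) (h2 : p ≠ 2) {k : ℕ} {a b c d r : ℤ}
    (hab : Int.gcd a b = 1) (hcd : Int.gcd c d = 1) (h1 : a ^ 2 + b ^ 2 = r)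
    (h3 : c ^ 2 + d ^ 2 = r) (hpr : (p : ℤ) ∣ r) (hk : (p : ℤ) ^ k ∣ r) :
    ((p : ℤ) ∣ a * d - c * b → (p : ℤ) ^ k ∣ a * d - c * b) ∧
    (¬ (p : ℤ) ∣ a * d - c * b → (p : ℤ) ^ k ∣ a * d + c * b) := by
  have hpz : Prime (p : ℤ) := Nat.prime_iff_prime_int.mp hp
  have hprod : (p : ℤ) ^ k ∣ (a * d - c * b) * (a * d + c * b) := by
    have : (a * d - c * b) * (a * d + c * b) = r * (a ^ 2 - c ^ 2) := by
      have hb : b ^ 2 = r - a ^ 2 := by linarith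
      have hd : d ^ 2 = r - c ^ 2 := by linarith
      calc _ = a ^ 2 * d ^ 2 - c ^ 2 * b ^ 2 := by ring
        _ = _ := by rw [hb, hd]; ring
    rw [this]; exact hk.mul_right _
  constructor
  · intro h
    refine (IsCoprime.pow_left ((Prime.coprime_iff_not_dvd hpz).mpr fun h' => ?_)).dvd_of_dvd_mul_right
      hprod
    have : (p : ℤ) ∣ 2 * (a * d) := by
      have := dvd_add h h'
      rwa [show a * d - c * b + (a * d + c * b) = 2 * (a * d) by ring] at this
    rcases hpz.dvd_or_dvd this with h4 | h4
    · have : p ∣ 2 := by exact_mod_cast h4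
      exact h2 ((Nat.prime_dvd_prime_iff_eq hp Nat.prime_two).mp this)
    · rcases hpz.dvd_or_dvd h4 with h5 | h5
      · exact (not_dvd_of_gcd_eq_one hpz hab h1 hpr).1 h5
      · exact (not_dvd_of_gcd_eq_one hpz hcd h3 hpr).2 h5
  · intro h
    exact (IsCoprime.pow_left ((Prime.coprime_iff_not_dvd hpz).mpr h)).dvd_of_dvd_mul_left hprod

/-- For each odd `p ∣ r`, the class of `z` relative to a reference `c` is one binary choice: which
of `z.1 * c.2 ∓ c.1 * z.2` the prime divides. Equal choices for `z` and `w` let `c` be eliminated,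
one prime power at a time. -/
theorem dvd_det_of_same_primes {r : ℕ} {z w c : ℤ × ℤ} (hz : z ∈ primitiveReps r)
    (hw : w ∈ primitiveReps r) (hc : c ∈ primitiveReps r)
    (h : ∀ p : ℕ, p.Prime → p ∣ r →
      ((p : ℤ) ∣ z.1 * c.2 - c.1 * z.2 ↔ (p : ℤ) ∣ w.1 * c.2 - c.1 * w.2)) :
    (r : ℤ) ∣ z.1 * w.2 - z.2 * w.1 := by
  rw [mem_primitiveReps] at hz hw hc
  rw [← Int.dvd_natAbs, Int.natCast_dvd_natCast, Nat.dvd_iff_prime_pow_dvd_dvd]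
  intro p k hp hk
  rcases Nat.eq_zero_or_pos k with rfl | hk0
  · simp
  have hpr : p ∣ r := (dvd_pow_self p hk0.ne').trans hk
  have hpz : Prime (p : ℤ) := Nat.prime_iff_prime_int.mp hp
  have hpr' : (p : ℤ) ∣ (r : ℤ) := Int.natCast_dvd_natCast.mpr hpr
  have hk' : (p : ℤ) ^ k ∣ (r : ℤ) := by exact_mod_cast hk
  rw [← Int.natCast_dvd_natCast, Int.dvd_natAbs]
  push_cast
  have nz := not_dvd_of_gcd_eq_one hpz hz.1 hz.2 hpr'
  have nw := not_dvd_of_gcd_eq_one hpz hw.1 hw.2 hpr'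
  have nc := not_dvd_of_gcd_eq_one hpz hc.1 hc.2 hpr'
  by_cases h2 : p = 2
  · subst h2
    have hodd : ∀ x : ℤ, ¬ ((2 : ℕ) : ℤ) ∣ x → Odd x := fun x hx => by
      rw [← Int.not_even_iff_odd, even_iff_two_dvd]; exact_mod_cast hx
    have o1 := hodd _ nz.1
    have o2 := hodd _ nz.2
    have o3 := hodd _ nw.1
    have o4 := hodd _ nw.2
    -- All coordinates are odd here, so `r ≡ 2 (mod 4)` and only parity has to be checked.
    have hk1 : k = 1 := by
      by_contra hne
      have h4 : (4 : ℤ) ∣ r := by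
        have : ((2 : ℕ) : ℤ) ^ 2 ∣ ((2 : ℕ) : ℤ) ^ k := pow_dvd_pow _ (by omega)
        simpa using this.trans hk'
      rw [← hz.2] at h4
      have e1 := Int.sq_mod_four_eq_one_of_odd o1
      have e2 := Int.sq_mod_four_eq_one_of_odd o2
      omega
    subst hk1
    have : Even (z.1 * w.2 - z.2 * w.1) := (o1.mul o4).sub_odd (o2.mul o3)
    simpa using even_iff_two_dvd.mp this
  · have a1 := odd_pow_dvd_or hp h2 hz.1 hc.1 hz.2 hc.2 hpr' hk'
    have a2 := odd_pow_dvd_or hp h2 hw.1 hc.1 hw.2 hc.2 hpr' hk'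
    have hcop : IsCoprime ((p : ℤ) ^ k) c.2 :=
      IsCoprime.pow_left ((Prime.coprime_iff_not_dvd hpz).mpr nc.2)
    refine hcop.dvd_of_dvd_mul_right (y := z.1 * w.2 - z.2 * w.1) ?_
    by_cases hd : (p : ℤ) ∣ z.1 * c.2 - c.1 * z.2
    · have b1 := a1.1 hd
      have b2 := a2.1 ((h p hp hpr).mp hd)
      have := dvd_sub (b1.mul_right w.2) (b2.mul_right z.2)
      rwa [show (z.1 * c.2 - c.1 * z.2) * w.2 - (w.1 * c.2 - c.1 * w.2) * z.2 =
        (z.1 * w.2 - z.2 * w.1) * c.2 by ring] at this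
    · have b1 := a1.2 hd
      have b2 := a2.2 (fun h' => hd ((h p hp hpr).mpr h'))
      have := dvd_sub (b1.mul_right w.2) (b2.mul_right z.2)
      rwa [show (z.1 * c.2 + c.1 * z.2) * w.2 - (w.1 * c.2 + c.1 * w.2) * z.2 =
        (z.1 * w.2 - z.2 * w.1) * c.2 by ring] at this

/-- The number of primitive vectors of squared norm `r` is at most `4 * 2 ^ ω(r)`. -/
theorem card_primitiveReps_le (r : ℕ) (hr : 0 < r) :
    (primitiveReps r).card ≤ 4 * 2 ^ ArithmeticFunction.cardDistinctFactors r := by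
  classical
  rcases (primitiveReps r).eq_empty_or_nonempty with he | ⟨c, hc⟩
  · rw [he]; simp
  -- `f` takes at most `2 ^ ω(r)` values, and each of its fibres lies in one orbit of the four
  -- quarter turns.
  set f : ℤ × ℤ → Finset ℕ := fun z =>
    r.primeFactors.filter fun p => (p : ℤ) ∣ z.1 * c.2 - c.1 * z.2 with hf
  have himg : ((primitiveReps r).image f).card ≤ 2 ^ ArithmeticFunction.cardDistinctFactors r := by
    have hsub : (primitiveReps r).image f ⊆ r.primeFactors.powerset := by
      intro s hs
      obtain ⟨z, -, rfl⟩ := Finset.mem_image.mp hs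
      exact Finset.mem_powerset.mpr (Finset.filter_subset _ _)
    calc _ ≤ r.primeFactors.powerset.card := Finset.card_le_card hsub
      _ = _ := by rw [Finset.card_powerset]; rfl
  refine (Finset.card_le_mul_card_image (f := f) _ 4 ?_).trans (Nat.mul_le_mul_left 4 himg)
  intro s hs
  obtain ⟨w, hw, rfl⟩ := Finset.mem_image.mp hs
  have hsub : {a ∈ primitiveReps r | f a = f w} ⊆
      {(w.1, w.2), (-w.1, -w.2), (w.2, -w.1), (-w.2, w.1)} := by
    intro z hz
    obtain ⟨hz, hzw⟩ := Finset.mem_filter.mp hz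
    have hd := dvd_det_of_same_primes hz hw hc (fun p hp hpr => by
      have := Finset.ext_iff.mp hzw p
      simp only [hf, Finset.mem_filter, Nat.mem_primeFactors] at this
      have h0 : p.Prime ∧ p ∣ r ∧ r ≠ 0 := ⟨hp, hpr, hr.ne'⟩
      simpa [h0] using this)
    have := eq_unit_mul_of_dvd_det (by exact_mod_cast hr) (mem_primitiveReps.mp hz).2
      (mem_primitiveReps.mp hw).2 hd
    simp only [Finset.mem_insert, Finset.mem_singleton, Prod.ext_iff]
    exact this
  exact (Finset.card_le_card hsub).trans Finset.card_le_four

/-! ### A divisor-sum identity for `τ²` -/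

/-- The arithmetic function `n ↦ 2 ^ ω(n)`. -/
def twoPowOmega : ArithmeticFunction ℕ :=
  ⟨fun n => if n = 0 then 0 else 2 ^ ArithmeticFunction.cardDistinctFactors n, by simp⟩

theorem twoPowOmega_apply {n : ℕ} (hn : n ≠ 0) :
    twoPowOmega n = 2 ^ ArithmeticFunction.cardDistinctFactors n := by
  simp [twoPowOmega, hn]

theorem isMultiplicative_twoPowOmega : twoPowOmega.IsMultiplicative := by
  rw [ArithmeticFunction.IsMultiplicative.iff_ne_zero]
  refine ⟨by simp [twoPowOmega], ?_⟩
  intro m n hm hn hmn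
  rw [twoPowOmega_apply hm, twoPowOmega_apply hn, twoPowOmega_apply (mul_ne_zero hm hn),
    ArithmeticFunction.cardDistinctFactors_mul hmn, pow_add]

/-- Both sides are multiplicative. At `p ^ i` the identity reads `(i + 1) + 2 (1 + ⋯ + i) = (i +
1)²`. -/
theorem sum_two_pow_omega_mul_numDivisors (n : ℕ) :
    ∑ d ∈ n.divisors, 2 ^ ArithmeticFunction.cardDistinctFactors d * numDivisors (n / d) =
      numDivisors n ^ 2 := by
  have key : twoPowOmega * ArithmeticFunction.sigma 0 =
      ArithmeticFunction.pmul (ArithmeticFunction.sigma 0) (ArithmeticFunction.sigma 0) := by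
    rw [(isMultiplicative_twoPowOmega.mul
      ArithmeticFunction.isMultiplicative_sigma).eq_iff_eq_on_prime_powers _ _
      (ArithmeticFunction.isMultiplicative_sigma.pmul ArithmeticFunction.isMultiplicative_sigma)]
    intro p i hp
    rw [ArithmeticFunction.mul_apply, ArithmeticFunction.pmul_apply,
      ArithmeticFunction.sigma_zero_apply_prime_pow hp,
      Nat.sum_divisorsAntidiagonal
        (f := fun a b => twoPowOmega a * ArithmeticFunction.sigma 0 b),
      Nat.sum_divisors_prime_pow hp]
    have e : ∀ j ∈ Finset.range (i + 1), twoPowOmega (p ^ j) *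
        ArithmeticFunction.sigma 0 (p ^ i / p ^ j) = (if j = 0 then 1 else 2) * (i - j + 1) := by
      intro j hj
      have hji : j ≤ i := Nat.lt_succ_iff.mp (Finset.mem_range.mp hj)
      rw [Nat.pow_div hji hp.pos, ArithmeticFunction.sigma_zero_apply_prime_pow hp,
        twoPowOmega_apply (pow_pos hp.pos _).ne']
      split_ifs with h0
      · subst h0; simp
      · rw [ArithmeticFunction.cardDistinctFactors_apply_prime_pow hp h0, pow_one]
    rw [Finset.sum_congr rfl e, ← Finset.sum_range_reflect]
    have e2 : ∀ j ∈ Finset.range (i + 1), (if i + 1 - 1 - j = 0 then 1 else 2) *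
        (i - (i + 1 - 1 - j) + 1) = if j = i then i + 1 else 2 * (j + 1) := by
      intro j hj
      have hji : j ≤ i := Nat.lt_succ_iff.mp (Finset.mem_range.mp hj)
      rcases eq_or_ne j i with rfl | hne
      · simp
      · rw [if_neg (by omega), if_neg hne]; congr 1; omega
    rw [Finset.sum_congr rfl e2, Finset.sum_range_succ, if_pos rfl,
      Finset.sum_congr rfl (g := fun j => 2 * (j + 1))
        (fun j hj => if_neg (Finset.mem_range.mp hj).ne)]
    have : ∀ i, ∑ j ∈ Finset.range i, 2 * (j + 1) = i * (i + 1) := by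
      intro i
      induction i with
      | zero => simp
      | succ k ih => rw [Finset.sum_range_succ, ih]; ring
    rw [this]; ring
  have := DFunLike.congr_fun key n
  rw [ArithmeticFunction.mul_apply, ArithmeticFunction.pmul_apply,
    Nat.sum_divisorsAntidiagonal
      (f := fun a b => twoPowOmega a * ArithmeticFunction.sigma 0 b)] at this
  simp only [ArithmeticFunction.sigma_zero_apply] at this
  rw [numDivisors, sq, ← this]
  refine Finset.sum_congr rfl fun d hd => ?_
  rw [twoPowOmega_apply (Nat.pos_of_mem_divisors hd).ne', numDivisors]

theorem numDivisors_two_mul_le (n : ℕ) : numDivisors (2 * n) ≤ 2 * numDivisors n := by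
  classical
  unfold numDivisors
  rw [Nat.divisors_mul]
  refine Finset.card_mul_le.trans ?_
  rw [Nat.prime_two.divisors, Finset.card_pair (by norm_num)]

/-! ### Plane lattices and bases of minimal vectors -/

theorem plane_norm_sq (v : Plane) : ‖v‖ ^ 2 = v 0 ^ 2 + v 1 ^ 2 := by
  rw [EuclideanSpace.real_norm_sq_eq, Fin.sum_univ_two]

theorem plane_ext {v w : Plane} (h0 : v 0 = w 0) (h1 : v 1 = w 1) : v = w := by
  ext i; fin_cases i <;> assumption

theorem mem_integerLattice {v : Plane} :
    v ∈ integerLattice ↔ ∃ a b : ℤ, v 0 = (a : ℝ) ∧ v 1 = (b : ℝ) := by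
  rw [integerLattice, Submodule.mem_span_range_iff_exists_fun]
  constructor
  · rintro ⟨c, rfl⟩
    exact ⟨c 0, c 1, by simp [Fin.sum_univ_two], by simp [Fin.sum_univ_two]⟩
  · rintro ⟨a, b, h0, h1⟩
    refine ⟨![a, b], plane_ext ?_ ?_⟩
    · simp [Fin.sum_univ_two, h0]
    · simp [Fin.sum_univ_two, h1]

theorem linearIndependent_pair_of_det_ne_zero {x y : Plane} (h : x 0 * y 1 - x 1 * y 0 ≠ 0) :
    LinearIndependent ℝ ![x, y] := by
  rw [LinearIndependent.pair_iff]
  intro s t hst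
  have e0 : s * x 0 + t * y 0 = 0 := by simpa using congrArg (fun v : Plane => v 0) hst
  have e1 : s * x 1 + t * y 1 = 0 := by simpa using congrArg (fun v : Plane => v 1) hst
  constructor
  · refine (mul_eq_zero.mp (?_ : s * (x 0 * y 1 - x 1 * y 0) = 0)).resolve_right h
    linear_combination y 1 * e0 - y 0 * e1
  · refine (mul_eq_zero.mp (?_ : t * (x 0 * y 1 - x 1 * y 0) = 0)).resolve_right h
    linear_combination x 0 * e1 - x 1 * e0

/-- The basis of the plane given by two vectors with nonzero determinant. -/
noncomputable def pairBasis {x y : Plane} (h : x 0 * y 1 - x 1 * y 0 ≠ 0) :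
    Module.Basis (Fin 2) ℝ Plane :=
  basisOfLinearIndependentOfCardEqFinrank (linearIndependent_pair_of_det_ne_zero h) (by simp)

theorem coe_pairBasis {x y : Plane} (h : x 0 * y 1 - x 1 * y 0 ≠ 0) :
    ⇑(pairBasis h) = ![x, y] := by
  simp [pairBasis]

theorem span_range_pairBasis {x y : Plane} (h : x 0 * y 1 - x 1 * y 0 ≠ 0) :
    Submodule.span ℤ (Set.range (pairBasis h)) = Submodule.span ℤ {x, y} := by
  rw [coe_pairBasis]; simp [Matrix.range_cons, Set.pair_comm]

theorem covolume_span_pair {x y : Plane} (h : x 0 * y 1 - x 1 * y 0 ≠ 0) :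
    ZLattice.covolume (Submodule.span ℤ {x, y}) = |x 0 * y 1 - x 1 * y 0| := by
  rw [← span_range_pairBasis h, ZLattice.covolume_eq_measure_fundamentalDomain _ _
    (ZSpan.isAddFundamentalDomain (pairBasis h) MeasureTheory.volume),
    ZSpan.measureReal_fundamentalDomain _ _ (EuclideanSpace.basisFun (Fin 2) ℝ).toBasis,
    MeasureTheory.measureReal_congr (ZSpan.fundamentalDomain_ae_parallelepiped _ _)]
  have hvol : MeasureTheory.volume.real
      (parallelepiped ⇑(EuclideanSpace.basisFun (Fin 2) ℝ).toBasis) = 1 := by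
    rw [MeasureTheory.Measure.real, OrthonormalBasis.coe_toBasis,
      OrthonormalBasis.volume_parallelepiped]
    rfl
  rw [hvol, mul_one, Module.Basis.det_apply, Matrix.det_fin_two]
  simp [Module.Basis.toMatrix_apply, coe_pairBasis]
  ring_nf

/-- Otherwise, for a minimal `x`, the linear form `v ↦ det (x, v)` would vanish on the span of the
minimal vectors, which is the whole plane. -/
theorem exists_minimal_pair {L : Submodule ℤ Plane} (hL : IsWellRounded L) :
    ∃ x ∈ minimalVectors L, ∃ y ∈ minimalVectors L, x 0 * y 1 - x 1 * y 0 ≠ 0 := by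
  by_contra! hcon
  have hne : (minimalVectors L).Nonempty := by
    by_contra he
    rw [Set.not_nonempty_iff_eq_empty] at he
    have : (⊥ : Submodule ℝ Plane) = ⊤ := by rw [← hL, he, Submodule.span_empty]
    exact bot_ne_top this
  obtain ⟨x, hx⟩ := hne
  have hall : ∀ v : Plane, x 0 * v 1 - x 1 * v 0 = 0 := by
    intro v
    have hv : v ∈ Submodule.span ℝ (minimalVectors L) := by
      rw [show Submodule.span ℝ (minimalVectors L) = ⊤ from hL]; trivial
    induction hv using Submodule.span_induction with
    | mem y hy => exact hcon x hx y hy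
    | zero => simp
    | add v w _ _ hv hw => simp only [PiLp.add_apply]; linarith
    | smul a v _ hv =>
      simp only [PiLp.smul_apply, smul_eq_mul]; linear_combination a * hv
  refine hx.2.1 (plane_ext ?_ ?_)
  · simpa using hall !₂[0, 1]
  · simpa using hall !₂[1, 0]

/-- For `|x|² = |y|² = N` and `⟨x, y⟩ = I` this bounds `|a x + b y|²`; the two terms contribute at
most `N / 2` and `N / 4`. -/
theorem quadratic_form_lt {N I a b : ℝ} (hN : 0 < N) (h1 : -N ≤ 2 * I) (h2 : 2 * I ≤ N)
    (ha : |a| ≤ 1 / 2) (hb : |b| ≤ 1 / 2) : (a ^ 2 + b ^ 2) * N + 2 * (a * b) * I < N := by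
  have a2 : a ^ 2 ≤ 1 / 4 := by rw [← sq_abs]; nlinarith [abs_nonneg a]
  have b2 : b ^ 2 ≤ 1 / 4 := by rw [← sq_abs]; nlinarith [abs_nonneg b]
  have hab : |a * b| ≤ 1 / 4 := by
    rw [abs_mul]; nlinarith [abs_nonneg a, abs_nonneg b]
  have hcross : 2 * (a * b) * I ≤ 1 / 4 * N := by
    calc 2 * (a * b) * I = a * b * (2 * I) := by ring
      _ ≤ |a * b * (2 * I)| := le_abs_self _
      _ = |a * b| * |2 * I| := abs_mul _ _
      _ ≤ 1 / 4 * N := mul_le_mul hab (abs_le.mpr ⟨h1, h2⟩) (abs_nonneg _) (by norm_num)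
  have : (a ^ 2 + b ^ 2) * N ≤ 1 / 2 * N := mul_le_mul_of_nonneg_right (by linarith) hN.le
  linarith

/-- Rounding the real coordinates of a lattice vector leaves a remainder in `L` with coordinates at
most `1 / 2` in absolute value. It is shorter than a minimal vector, hence zero. -/
theorem eq_span_of_minimal_pair {L : Submodule ℤ Plane} {x y : Plane} (hx : x ∈ minimalVectors L)
    (hy : y ∈ minimalVectors L) (h : x 0 * y 1 - x 1 * y 0 ≠ 0) :
    L = Submodule.span ℤ {x, y} := by
  apply le_antisymm
  · intro v hv
    set D := x 0 * y 1 - x 1 * y 0 with hD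
    set α := (v 0 * y 1 - v 1 * y 0) / D with hα
    set β := (x 0 * v 1 - x 1 * v 0) / D with hβ
    have hv0 : v 0 = α * x 0 + β * y 0 := by
      rw [hα, hβ]; field_simp; rw [hD]; ring
    have hv1 : v 1 = α * x 1 + β * y 1 := by
      rw [hα, hβ]; field_simp; rw [hD]; ring
    set w : Plane := v - (round α • x + round β • y) with hw
    have hwL : w ∈ L := L.sub_mem hv (L.add_mem (L.smul_mem _ hx.1) (L.smul_mem _ hy.1))
    have hw0 : w 0 = (α - round α) * x 0 + (β - round β) * y 0 := by
      simp [hw, hv0]; ring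
    have hw1 : w 1 = (α - round α) * x 1 + (β - round β) * y 1 := by
      simp [hw, hv1]; ring
    set a := α - round α with ha
    set b := β - round β with hb
    have hsq : ∀ {v w : Plane}, ‖v‖ ≤ ‖w‖ → v 0 ^ 2 + v 1 ^ 2 ≤ w 0 ^ 2 + w 1 ^ 2 := by
      intro v w hvw
      rw [← plane_norm_sq, ← plane_norm_sq]
      exact pow_le_pow_left₀ (norm_nonneg _) hvw 2
    have hN : x 0 ^ 2 + x 1 ^ 2 = y 0 ^ 2 + y 1 ^ 2 :=
      le_antisymm (hsq (hx.2.2 y hy.1 hy.2.1)) (hsq (hy.2.2 x hx.1 hx.2.1))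
    -- Comparing `x` with `x ± y` gives `|2 ⟨x, y⟩| ≤ N`. Neither `x + y` nor `x - y` vanishes,
    -- since the determinant is nonzero.
    have hadd : x 0 ^ 2 + x 1 ^ 2 ≤ (x 0 + y 0) ^ 2 + (x 1 + y 1) ^ 2 := by
      refine hsq (hx.2.2 (x + y) (L.add_mem hx.1 hy.1) fun h0 => h ?_)
      have e : y = -x := (neg_eq_of_add_eq_zero_right h0).symm
      simp [hD, e]; ring
    have hsub : x 0 ^ 2 + x 1 ^ 2 ≤ (x 0 - y 0) ^ 2 + (x 1 - y 1) ^ 2 := by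
      refine hsq (hx.2.2 (x - y) (L.sub_mem hx.1 hy.1) fun h0 => h ?_)
      have e : x = y := sub_eq_zero.mp h0
      simp [hD, e]; ring
    have hNpos : 0 < x 0 ^ 2 + x 1 ^ 2 := by
      rw [← plane_norm_sq]; have := norm_pos_iff.mpr hx.2.1; positivity
    have hwz : w = 0 := by
      by_contra hne
      have hle := hsq (hx.2.2 w hwL hne)
      rw [hw0, hw1] at hle
      set N := x 0 ^ 2 + x 1 ^ 2 with hNdef
      set I := x 0 * y 0 + x 1 * y 1 with hI
      have e : (a * x 0 + b * y 0) ^ 2 + (a * x 1 + b * y 1) ^ 2 =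
          (a ^ 2 + b ^ 2) * N + 2 * (a * b) * I := by
        rw [hI]; linear_combination (-b ^ 2) * hN
      have i1 : -N ≤ 2 * I := by rw [hI]; linarith
      have i2 : 2 * I ≤ N := by rw [hI]; linarith
      rw [e] at hle
      exact absurd hle (not_le.mpr (quadratic_form_lt hNpos i1 i2 (abs_sub_round α) (abs_sub_round β)))
    have : v = round α • x + round β • y := sub_eq_zero.mp hwz
    rw [this, Submodule.mem_span_pair]
    exact ⟨_, _, rfl⟩
  · rw [Submodule.span_le]
    rintro v (rfl | rfl)
    · exact hx.1
    · exact hy.1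

/-! ### Parametrising the well-rounded lattices of given determinant -/

/-- The lattice spanned by the two vectors with sum `g z` and difference `n i z`. -/
noncomputable def rhombicLattice (z : ℤ × ℤ) (g n : ℤ) : Submodule ℤ Plane :=
  Submodule.span ℤ {!₂[((g * z.1 - n * z.2 : ℤ) : ℝ) / 2, ((g * z.2 + n * z.1 : ℤ) : ℝ) / 2],
    !₂[((g * z.1 + n * z.2 : ℤ) : ℝ) / 2, ((g * z.2 - n * z.1 : ℤ) : ℝ) / 2]}

/-- Equal norms make sum and difference orthogonal. With `g` the gcd of the coordinates of the sum,
the difference is orthogonal to the primitive vector `z`, and a Bézout relation for `z` shows that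
it is an integral multiple of `i z`. -/
theorem exists_rhombic_parameters {a b c d : ℤ} (h : a ^ 2 + b ^ 2 = c ^ 2 + d ^ 2)
    (h0 : a * d - b * c ≠ 0) :
    ∃ (z : ℤ × ℤ) (g : ℕ) (n : ℤ), Int.gcd z.1 z.2 = 1 ∧ a + c = g * z.1 ∧ b + d = g * z.2 ∧
      a - c = -(n * z.2) ∧ b - d = n * z.1 ∧
      2 * (a * d - b * c).natAbs = g * n.natAbs * (z.1 ^ 2 + z.2 ^ 2).natAbs := by
  have hp : 0 < Int.gcd (a + c) (b + d) := by
    rw [Int.gcd_pos_iff]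
    by_contra! hcon
    apply h0
    rw [show a = -c by linarith [hcon.1], show b = -d by linarith [hcon.2]]; ring
  obtain ⟨z1, z2, hz, e1, e2⟩ := Int.exists_gcd_one hp
  set g := Int.gcd (a + c) (b + d) with hg
  have horth : z1 * (a - c) + z2 * (b - d) = 0 := by
    have : (g : ℤ) * (z1 * (a - c) + z2 * (b - d)) = 0 := by
      linear_combination -(a - c) * e1 - (b - d) * e2 + h
    exact (mul_eq_zero.mp this).resolve_left (by exact_mod_cast hp.ne')
  have hcop : IsCoprime z1 z2 := Int.isCoprime_iff_gcd_eq_one.mpr hz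
  obtain ⟨s, t, hst⟩ := hcop
  have f1 : a - c = -((s * (b - d) - t * (a - c)) * z2) := by
    linear_combination (-(a - c)) * hst + s * horth
  have f2 : b - d = (s * (b - d) - t * (a - c)) * z1 := by
    linear_combination (-(b - d)) * hst + t * horth
  set n := s * (b - d) - t * (a - c)
  refine ⟨(z1, z2), g, n, hz, by rw [mul_comm]; exact e1, by rw [mul_comm]; exact e2, f1, f2, ?_⟩
  have : 2 * (a * d - b * c) = -(g * n * (z1 ^ 2 + z2 ^ 2)) := by
    have : 2 * (a * d - b * c) = -((a + c) * (b - d) - (b + d) * (a - c)) := by ring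
    rw [this, f1, f2, e1, e2]; ring
  have := congrArg Int.natAbs this
  simpa [Int.natAbs_mul] using this

/-- Parameters for the lattices of determinant `u`. -/
noncomputable def wrParameters (u : ℕ) : Finset (Σ _ : ℕ, (ℤ × ℤ) × ℕ × ℤ) :=
  (2 * u).divisors.sigma fun r => primitiveReps r ×ˢ (2 * u / r).divisors ×ˢ {1, -1}

theorem card_wrParameters_le (u : ℕ) : (wrParameters u).card ≤ 32 * numDivisors u ^ 2 := by
  rw [wrParameters, Finset.card_sigma]
  calc _ ≤ ∑ r ∈ (2 * u).divisors,
        8 * (2 ^ ArithmeticFunction.cardDistinctFactors r * numDivisors (2 * u / r)) := by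
        refine Finset.sum_le_sum fun r hr => ?_
        rw [Finset.card_product, Finset.card_product]
        have h1 := card_primitiveReps_le r (Nat.pos_of_mem_divisors hr)
        have h2 : ({1, -1} : Finset ℤ).card ≤ 2 := Finset.card_le_two
        calc _ ≤ 4 * 2 ^ ArithmeticFunction.cardDistinctFactors r *
              (numDivisors (2 * u / r) * 2) :=
              Nat.mul_le_mul h1 (Nat.mul_le_mul le_rfl h2)
          _ = _ := by ring
    _ = 8 * numDivisors (2 * u) ^ 2 := by
        rw [← Finset.mul_sum, sum_two_pow_omega_mul_numDivisors]
    _ ≤ 8 * (2 * numDivisors u) ^ 2 := by gcongr; exact numDivisors_two_mul_le u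
    _ = _ := by ring

/-- Only surjectivity of the parametrisation is needed for an upper bound. The size of `n` is
recovered as `2u / r / g`, so only its sign is a parameter. -/
theorem wrLatticesOfDet_subset {u : ℕ} (hu : 0 < u) :
    wrLatticesOfDet u ⊆
      (fun t : Σ _ : ℕ, (ℤ × ℤ) × ℕ × ℤ => rhombicLattice t.2.1 t.2.2.1
        (t.2.2.2 * ((2 * u / t.1 / t.2.2.1 : ℕ) : ℤ))) '' (wrParameters u : Set _) := by
  rintro L ⟨⟨hLZ, -, hwr⟩, hcov⟩
  obtain ⟨x, hx, y, hy, hD⟩ := exists_minimal_pair hwr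
  have hspan := eq_span_of_minimal_pair hx hy hD
  rw [hspan, covolume_span_pair hD] at hcov
  obtain ⟨a, b, hx0, hx1⟩ := mem_integerLattice.mp (hLZ hx.1)
  obtain ⟨c, d, hy0, hy1⟩ := mem_integerLattice.mp (hLZ hy.1)
  have hN : a ^ 2 + b ^ 2 = c ^ 2 + d ^ 2 := by
    have : ‖x‖ ^ 2 = ‖y‖ ^ 2 := by
      rw [le_antisymm (hx.2.2 y hy.1 hy.2.1) (hy.2.2 x hx.1 hx.2.1)]
    rw [plane_norm_sq, plane_norm_sq, hx0, hx1, hy0, hy1] at this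
    have h : (a : ℝ) ^ 2 + (b : ℝ) ^ 2 = (c : ℝ) ^ 2 + (d : ℝ) ^ 2 := this
    exact_mod_cast h
  have hdet : (a * d - b * c).natAbs = u := by
    rw [hx0, hx1, hy0, hy1] at hcov
    have h : |(a : ℝ) * d - (b : ℝ) * c| = (u : ℝ) := hcov
    have : |a * d - b * c| = (u : ℤ) := by exact_mod_cast h
    rw [Int.abs_eq_natAbs] at this
    exact_mod_cast this
  have h0 : a * d - b * c ≠ 0 := by
    intro h; rw [h] at hdet; simp at hdet; omega
  obtain ⟨z, g, n, hz, e1, e2, f1, f2, hdn⟩ := exists_rhombic_parameters hN h0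
  rw [hdet] at hdn
  set r := (z.1 ^ 2 + z.2 ^ 2).natAbs with hr
  have hgnr : 0 < g * n.natAbs * r := by omega
  have hrpos : 0 < r := Nat.pos_of_mul_pos_left hgnr
  have hgn : 0 < g * n.natAbs := Nat.pos_of_mul_pos_right hgnr
  have hgpos : 0 < g := Nat.pos_of_mul_pos_right hgn
  have hdiv : 2 * u / r = g * n.natAbs := by rw [hdn, Nat.mul_div_cancel _ hrpos]
  have hdiv2 : 2 * u / r / g = n.natAbs := by rw [hdiv, Nat.mul_div_cancel_left _ hgpos]
  refine ⟨⟨r, z, g, if 0 ≤ n then 1 else -1⟩, ?_, ?_⟩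
  · simp only [wrParameters, Finset.coe_sigma, Set.mem_sigma_iff, Finset.mem_coe,
      Finset.mem_product, Nat.mem_divisors, mem_primitiveReps]
    refine ⟨⟨⟨_, hdn.trans (mul_comm _ _)⟩, by omega⟩, ⟨hz, ?_⟩, ⟨?_, ?_⟩, ?_⟩
    · rw [hr, Int.natAbs_of_nonneg (by positivity)]
    · rw [hdiv]; exact dvd_mul_right _ _
    · rw [hdiv]; exact hgn.ne'
    · split_ifs <;> simp
  · have hn : (if 0 ≤ n then (1 : ℤ) else -1) * ((2 * u / r / g : ℕ) : ℤ) = n := by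
      rw [hdiv2]; split_ifs <;> omega
    simp only [hn]
    rw [hspan, rhombicLattice]
    have g1 : (a : ℝ) + c = g * z.1 := by exact_mod_cast e1
    have g2 : (b : ℝ) + d = g * z.2 := by exact_mod_cast e2
    have g3 : (a : ℝ) - c = -(n * z.2) := by exact_mod_cast f1
    have g4 : (b : ℝ) - d = n * z.1 := by exact_mod_cast f2
    congr 2
    · apply plane_ext
      · simp [hx0]; linarith
      · simp [hx1]; linarith
    · congr 1
      apply plane_ext
      · simp [hy0]; linarith
      · simp [hy1]; linarith

theorem finite_wrLatticesOfDet {u : ℕ} (hu : 0 < u) : (wrLatticesOfDet u).Finite :=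
  ((wrParameters u).finite_toSet.image _).subset (wrLatticesOfDet_subset hu)

/-- The number of well-rounded lattices of determinant `u` is `O(τ(u)²)`. -/
theorem wrCount_le {u : ℕ} (hu : 0 < u) : wrCount u ≤ 32 * numDivisors u ^ 2 := by
  have hfin := (wrParameters u).finite_toSet
  refine ((Set.ncard_le_ncard (wrLatticesOfDet_subset hu) (hfin.image _)).trans
    (Set.ncard_image_le hfin)).trans ?_
  rw [Set.ncard_coe_finset]
  exact card_wrParameters_le u

/-! ### Square lattices from Gaussian integers -/

/-- A Gaussian integer as a point of the plane. -/
noncomputable def gaussPoint (z : GaussianInt) : Plane := !₂[(z.re : ℝ), (z.im : ℝ)]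

theorem gaussPoint_zero (z : GaussianInt) : gaussPoint z 0 = (z.re : ℝ) := rfl

theorem gaussPoint_one (z : GaussianInt) : gaussPoint z 1 = (z.im : ℝ) := rfl

theorem gaussPoint_injective : Function.Injective gaussPoint := by
  intro z w h
  have h0 : (z.re : ℝ) = w.re := congrArg (fun v : Plane => v 0) h
  have h1 : (z.im : ℝ) = w.im := congrArg (fun v : Plane => v 1) h
  exact Zsqrtd.ext (by exact_mod_cast h0) (by exact_mod_cast h1)

/-- The square lattice of multiples of a Gaussian integer. -/
noncomputable def gaussLattice (z : GaussianInt) : Submodule ℤ Plane :=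
  Submodule.span ℤ {gaussPoint z, gaussPoint (z * ⟨0, 1⟩)}

theorem mem_gaussLattice {z : GaussianInt} {v : Plane} :
    v ∈ gaussLattice z ↔ ∃ w, v = gaussPoint (z * w) := by
  rw [gaussLattice, Submodule.mem_span_pair]
  constructor
  · rintro ⟨m, n, rfl⟩
    refine ⟨⟨m, n⟩, plane_ext ?_ ?_⟩
    · simp [gaussPoint]; ring
    · simp [gaussPoint]; ring
  · rintro ⟨w, rfl⟩
    refine ⟨w.re, w.im, plane_ext ?_ ?_⟩
    · simp [gaussPoint]; ring
    · simp [gaussPoint]; ring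

theorem gaussPoint_mem_gaussLattice_iff {z w : GaussianInt} :
    gaussPoint w ∈ gaussLattice z ↔ z ∣ w := by
  rw [mem_gaussLattice]
  exact ⟨fun ⟨c, hc⟩ => ⟨c, gaussPoint_injective hc⟩, fun ⟨c, hc⟩ => ⟨c, by rw [hc]⟩⟩

theorem norm_gaussPoint_sq (z : GaussianInt) : ‖gaussPoint z‖ ^ 2 = (z.norm : ℝ) := by
  rw [plane_norm_sq, gaussPoint_zero, gaussPoint_one, Zsqrtd.norm_def]; push_cast; ring

theorem gaussPoint_mem_minimalVectors {z w : GaussianInt} (hz : z ≠ 0) (hw : w.norm = 1) :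
    gaussPoint (z * w) ∈ minimalVectors (gaussLattice z) := by
  have hzn : 0 < z.norm := GaussianInt.norm_pos.mpr hz
  refine ⟨gaussPoint_mem_gaussLattice_iff.mpr (dvd_mul_right _ _), ?_, ?_⟩
  · intro h0
    have := norm_gaussPoint_sq (z * w)
    rw [h0, Zsqrtd.norm_mul, hw, mul_one, norm_zero] at this
    have : (z.norm : ℝ) = 0 := by rw [← this]; norm_num
    exact hzn.ne' (by exact_mod_cast this)
  · intro y hy hy0
    obtain ⟨c, rfl⟩ := mem_gaussLattice.mp hy
    refine le_of_sq_le_sq ?_ (norm_nonneg _)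
    rw [norm_gaussPoint_sq, norm_gaussPoint_sq, Zsqrtd.norm_mul, Zsqrtd.norm_mul, hw]
    have hc : c ≠ 0 := by
      rintro rfl
      exact hy0 (plane_ext (by simp [gaussPoint]) (by simp [gaussPoint]))
    have hcn : 1 ≤ c.norm := Int.add_one_le_iff.mpr (GaussianInt.norm_pos.mpr hc)
    exact_mod_cast mul_le_mul_of_nonneg_left hcn hzn.le

theorem gaussLattice_mem_wrLatticesOfDet {z : GaussianInt} {u : ℕ} (hu : 0 < u)
    (hz : z.norm = u) : gaussLattice z ∈ wrLatticesOfDet u := by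
  have hz0 : z ≠ 0 := by
    rintro rfl
    rw [Zsqrtd.norm_zero] at hz
    omega
  have hdet : gaussPoint z 0 * gaussPoint (z * ⟨0, 1⟩) 1 -
      gaussPoint z 1 * gaussPoint (z * ⟨0, 1⟩) 0 = (u : ℝ) := by
    have : (z.norm : ℝ) = u := by exact_mod_cast hz
    rw [← this, Zsqrtd.norm_def]
    simp [gaussPoint]
  have hne : gaussPoint z 0 * gaussPoint (z * ⟨0, 1⟩) 1 -
      gaussPoint z 1 * gaussPoint (z * ⟨0, 1⟩) 0 ≠ 0 := by
    rw [hdet]; exact Nat.cast_ne_zero.mpr hu.ne'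
  have hspan : Submodule.span ℝ {gaussPoint z, gaussPoint (z * ⟨0, 1⟩)} = ⊤ := by
    rw [← (pairBasis hne).span_eq, coe_pairBasis]
    simp [Matrix.range_cons, Set.pair_comm]
  refine ⟨⟨?_, ?_, ?_⟩, ?_⟩
  · intro v hv
    obtain ⟨w, rfl⟩ := mem_gaussLattice.mp hv
    exact mem_integerLattice.mpr ⟨_, _, rfl, rfl⟩
  · rw [eq_top_iff, ← hspan]
    exact Submodule.span_mono Submodule.subset_span
  · rw [IsWellRounded, eq_top_iff, ← hspan]
    refine Submodule.span_mono ?_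
    rintro v (rfl | rfl)
    · have := gaussPoint_mem_minimalVectors hz0 (w := 1) Zsqrtd.norm_one
      rwa [mul_one] at this
    · exact gaussPoint_mem_minimalVectors hz0 (by simp [Zsqrtd.norm_def])
  · rw [gaussLattice, covolume_span_pair hne, hdet]
    simp

theorem gaussian_prime_of_norm {z : GaussianInt} {p : ℕ} (hp : p.Prime) (hz : z.norm = p) :
    Prime z := by
  rw [← irreducible_iff_prime, irreducible_iff]
  have hu : ∀ w : GaussianInt, IsUnit w ↔ w.norm.natAbs = 1 := fun w => Zsqrtd.norm_eq_one_iff.symm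
  refine ⟨fun h => ?_, fun a b hab => ?_⟩
  · rw [hu, hz] at h
    exact hp.one_lt.ne' (by simpa using h)
  · rw [hu, hu]
    have h : a.norm.natAbs * b.norm.natAbs = p := by
      rw [← Int.natAbs_mul, ← Zsqrtd.norm_mul, ← hab, hz]; rfl
    rcases (Nat.dvd_prime hp).mp ⟨_, h.symm⟩ with h1 | h1
    · exact Or.inl h1
    · right
      rw [h1] at h
      exact Nat.eq_of_mul_eq_mul_left hp.pos (by rw [h, mul_one])

theorem norm_dvd_norm {z w : GaussianInt} (h : z ∣ w) : z.norm ∣ w.norm := by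
  obtain ⟨c, rfl⟩ := h
  exact ⟨_, Zsqrtd.norm_mul _ _⟩

/-- If `z` divided its conjugate it would divide twice its real part. Then `p` divides both
coordinates of `z`, and `p²` divides the norm `p`. -/
theorem not_dvd_star {z : GaussianInt} {p : ℕ} (hp : p.Prime) (h2 : p ≠ 2) (hz : z.norm = p) :
    ¬ z ∣ star z := by
  intro h
  have h1 : z ∣ z + star z := dvd_add dvd_rfl h
  have h3 := norm_dvd_norm h1
  have e : (z + star z).norm = 4 * z.re ^ 2 := by simp [Zsqrtd.norm_def]; ring
  rw [e, hz] at h3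
  have hpz : Prime (p : ℤ) := Nat.prime_iff_prime_int.mp hp
  have hre : (p : ℤ) ∣ z.re := by
    rcases hpz.dvd_or_dvd h3 with h4 | h4
    · have h5 : p ∣ 2 ^ 2 := by exact_mod_cast h4
      exact absurd ((Nat.prime_dvd_prime_iff_eq hp Nat.prime_two).mp (hp.dvd_of_dvd_pow h5)) h2
    · exact hpz.dvd_of_dvd_pow h4
  have hsum : z.re ^ 2 + z.im ^ 2 = p := by rw [← hz, Zsqrtd.norm_def]; ring
  have him : (p : ℤ) ∣ z.im := by
    refine hpz.dvd_of_dvd_pow (n := 2) ((dvd_add_right (dvd_pow hre two_ne_zero)).mp ?_)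
    rw [hsum]
  have hsq : (p : ℤ) ^ 2 ∣ p := by
    nth_rewrite 2 [← hsum]
    exact dvd_add (pow_dvd_pow_of_dvd hre 2) (pow_dvd_pow_of_dvd him 2)
  have h6 : p ^ 2 ∣ p := by exact_mod_cast hsq
  have := Nat.le_of_dvd hp.pos h6
  nlinarith [hp.two_le]

theorem exists_gaussian_norm_eq {p : ℕ} (hp : p.Prime) (h4 : p % 4 = 1) :
    ∃ z : GaussianInt, z.norm = p := by
  have := Fact.mk hp
  obtain ⟨a, b, h⟩ := Nat.Prime.sq_add_sq (p := p) (by omega)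
  refine ⟨⟨a, b⟩, ?_⟩
  rw [Zsqrtd.norm_def, ← h]; push_cast; ring

/-- A product of `t` squares of primes `≡ 1 (mod 4)` is the determinant of at least `2 ^ t`
square lattices. -/
theorem two_pow_card_le_wrCount {S : Finset ℕ} (hS : ∀ p ∈ S, p.Prime ∧ p % 4 = 1) :
    2 ^ S.card ≤ wrCount (∏ p ∈ S, p ^ 2) ∧ ∏ p ∈ S, p ^ 2 ∈ determinantSet := by
  classical
  have hex : ∀ p : ℕ, ∃ z : GaussianInt, p ∈ S → z.norm = p := fun p => by
    by_cases hp : p ∈ S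
    · obtain ⟨z, hz⟩ := exists_gaussian_norm_eq (hS p hp).1 (hS p hp).2
      exact ⟨z, fun _ => hz⟩
    · exact ⟨0, fun h => absurd h hp⟩
  choose π hπ using hex
  set f : Finset ℕ → ℕ → GaussianInt := fun T p => if p ∈ T then π p else star (π p) with hf
  have hfn : ∀ T, ∀ p ∈ S, (f T p).norm = p := by
    intro T p hp
    simp only [hf]
    split_ifs
    · exact hπ p hp
    · rw [Zsqrtd.norm_conj, hπ p hp]
  have hu : 0 < ∏ p ∈ S, p ^ 2 := Finset.prod_pos fun p hp => pow_pos (hS p hp).1.pos 2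
  have hmem : ∀ T, gaussLattice (∏ p ∈ S, f T p ^ 2) ∈ wrLatticesOfDet (∏ p ∈ S, p ^ 2) := by
    intro T
    refine gaussLattice_mem_wrLatticesOfDet hu ?_
    have : (∏ p ∈ S, f T p ^ 2).norm = ∏ p ∈ S, (f T p ^ 2).norm :=
      map_prod (Zsqrtd.normMonoidHom (d := -1)) _ _
    rw [this, Nat.cast_prod]
    refine Finset.prod_congr rfl fun p hp => ?_
    rw [sq, Zsqrtd.norm_mul, hfn T p hp]; push_cast; ring
  -- If `p ∈ T \ T'`, then `π p` divides the first generator. By comparing norms it could divide the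
  -- second only through its own conjugate, which `not_dvd_star` forbids.
  have hsub : ∀ T T' : Finset ℕ, T ⊆ S → gaussLattice (∏ p ∈ S, f T p ^ 2) =
      gaussLattice (∏ p ∈ S, f T' p ^ 2) → T ⊆ T' := by
    intro T T' hT heq p hp
    by_contra hp'
    have hpS := hT hp
    have hdvd : ∏ p ∈ S, f T p ^ 2 ∣ ∏ p ∈ S, f T' p ^ 2 := by
      rw [← gaussPoint_mem_gaussLattice_iff, heq, gaussPoint_mem_gaussLattice_iff]
    have h1 : π p ∣ ∏ p ∈ S, f T p ^ 2 := by
      refine dvd_trans ?_ (Finset.dvd_prod_of_mem _ hpS)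
      simp only [hf, if_pos hp]
      exact dvd_pow_self _ two_ne_zero
    have hprime := gaussian_prime_of_norm (hS p hpS).1 (hπ p hpS)
    obtain ⟨q, hq, hpq⟩ := (Prime.dvd_finsetProd_iff hprime _).mp (h1.trans hdvd)
    have h2 : π p ∣ f T' q := hprime.dvd_of_dvd_pow hpq
    have h3 := norm_dvd_norm h2
    rw [hπ p hpS, hfn T' q hq] at h3
    have h4 : p = q := (Nat.prime_dvd_prime_iff_eq (hS p hpS).1 (hS q hq).1).mp
      (by exact_mod_cast h3)
    subst h4
    simp only [hf, if_neg hp'] at h2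
    have := (hS p hpS).2
    exact not_dvd_star (hS p hpS).1 (by omega) (hπ p hpS) h2
  refine ⟨?_, ⟨_, hmem ∅⟩⟩
  rw [← Finset.card_powerset, ← Set.ncard_coe_finset]
  -- `ncard` is `0` on infinite sets, so the finiteness of the target is essential here.
  refine Set.ncard_le_ncard_of_injOn (fun T => gaussLattice (∏ p ∈ S, f T p ^ 2))
    (fun T _ => hmem T) ?_ (finite_wrLatticesOfDet hu)
  intro T hT T' hT' heq
  have hT : T ⊆ S := Finset.mem_powerset.mp hT
  have hT' : T' ⊆ S := Finset.mem_powerset.mp hT'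
  exact Finset.Subset.antisymm (hsub T T' hT heq) (hsub T' T hT' heq.symm)

/-! ### Bounding `τ(u)` by a power of `log u / ω(u)` -/

theorem prod_le_arith_mean_pow {ι : Type*} (s : Finset ι) (z : ι → ℝ) (hz : ∀ i ∈ s, 0 ≤ z i) :
    ∏ i ∈ s, z i ≤ ((∑ i ∈ s, z i) / s.card) ^ s.card := by
  rcases s.eq_empty_or_nonempty with rfl | hs
  · simp
  have hc : 0 < s.card := hs.card_pos
  have h := Real.geom_mean_le_arith_mean s (fun _ => 1) z (fun _ _ => zero_le_one)
    (by simpa using hs) hz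
  simp only [Real.rpow_one, Finset.sum_const, nsmul_eq_mul, mul_one, one_mul] at h
  have hp : 0 ≤ ∏ i ∈ s, z i := Finset.prod_nonneg hz
  calc ∏ i ∈ s, z i = ((∏ i ∈ s, z i) ^ ((s.card : ℝ)⁻¹)) ^ s.card :=
        (Real.rpow_inv_natCast_pow hp hc.ne').symm
    _ ≤ _ := pow_le_pow_left₀ (Real.rpow_nonneg hp _) h _

/-- Since `a + 1 ≤ 2a`, it suffices that `log p ≥ 2` for `p ≥ 11`, and that `3 log 2 ≥ 2` for the
smaller primes. -/
theorem succ_le_const_mul_log {p a : ℕ} (hp : p.Prime) (ha : 1 ≤ a) :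
    ((a + 1 : ℕ) : ℝ) ≤ (if p < 11 then 3 else 1) * (a * Real.log p) := by
  have ha' : (1 : ℝ) ≤ a := by exact_mod_cast ha
  push_cast
  split_ifs with h
  · have h2 : Real.log 2 ≤ Real.log p :=
      Real.log_le_log (by norm_num) (by exact_mod_cast hp.two_le)
    have := Real.log_two_gt_d9
    nlinarith
  · have h2 : 2 ≤ Real.log p := by
      rw [Real.le_log_iff_exp_le (by exact_mod_cast hp.pos)]
      have h11 : (11 : ℝ) ≤ p := by exact_mod_cast not_lt.mp h
      have : Real.exp 2 = Real.exp 1 * Real.exp 1 := by rw [← Real.exp_add]; norm_num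
      have := Real.exp_one_lt_d9
      have := Real.exp_pos 1
      nlinarith
    nlinarith

/-- AM-GM applied to the numbers `a_p log p`, whose sum is `log u`. For `u = 1` the right-hand power
is `0 ^ 0 = 1`. -/
theorem numDivisors_le_log_div_pow {u : ℕ} (hu : 0 < u) :
    (numDivisors u : ℝ) ≤ 3 ^ 11 *
      (Real.log u / (ArithmeticFunction.cardDistinctFactors u : ℝ)) ^
        ArithmeticFunction.cardDistinctFactors u := by
  have hω : ArithmeticFunction.cardDistinctFactors u = u.primeFactors.card := rfl
  have hlog : Real.log u = ∑ p ∈ u.primeFactors, u.factorization p * Real.log p :=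
    Real.log_nat_eq_sum_factorization u
  rw [hω, hlog, numDivisors, Nat.card_divisors hu.ne', Nat.cast_prod]
  have hz : ∀ p ∈ u.primeFactors, (0 : ℝ) ≤ u.factorization p * Real.log p := fun p hp =>
    mul_nonneg (Nat.cast_nonneg _) (Real.log_natCast_nonneg p)
  calc _ ≤ ∏ p ∈ u.primeFactors,
        (if p < 11 then (3 : ℝ) else 1) * (u.factorization p * Real.log p) := by
        refine Finset.prod_le_prod (fun _ _ => Nat.cast_nonneg _) fun p hp => ?_
        have hpp := Nat.prime_of_mem_primeFactors hp
        exact succ_le_const_mul_log hpp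
          (hpp.factorization_pos_of_dvd hu.ne' (Nat.dvd_of_mem_primeFactors hp))
    _ = (∏ p ∈ u.primeFactors, if p < 11 then (3 : ℝ) else 1) *
        ∏ p ∈ u.primeFactors, (u.factorization p * Real.log p) := Finset.prod_mul_distrib
    _ ≤ _ := by
        refine mul_le_mul ?_ (prod_le_arith_mean_pow _ _ hz) (Finset.prod_nonneg hz) (by positivity)
        rw [Finset.prod_ite, Finset.prod_const, Finset.prod_const_one, mul_one]
        refine pow_le_pow_right₀ (by norm_num) ?_
        -- The crude count of all integers below 11 produces the constant `3 ^ 11`.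
        calc _ ≤ (Finset.range 11).card := Finset.card_le_card fun p hp =>
              Finset.mem_range.mpr (Finset.mem_filter.mp hp).2
          _ = 11 := Finset.card_range 11

theorem numDivisors_sq_mul_two_pow_le {u : ℕ} (hu : 0 < u) :
    (numDivisors u : ℝ) ^ 2 * 2 ^ ArithmeticFunction.cardDistinctFactors u ≤
      3 ^ 22 * (Real.sqrt 2 * Real.log u / (ArithmeticFunction.cardDistinctFactors u : ℝ)) ^
        (2 * ArithmeticFunction.cardDistinctFactors u) := by
  set w := ArithmeticFunction.cardDistinctFactors u
  have h := pow_le_pow_left₀ (Nat.cast_nonneg _) (numDivisors_le_log_div_pow hu) 2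
  have hs : Real.sqrt 2 ^ (2 * w) = 2 ^ w := by
    rw [pow_mul, Real.sq_sqrt (by norm_num)]
  rw [mul_div_assoc, mul_pow (Real.sqrt 2), hs]
  calc _ ≤ (3 ^ 11 * (Real.log u / (w : ℝ)) ^ w) ^ 2 * 2 ^ w := by gcongr
    _ = _ := by rw [mul_pow, ← pow_mul, ← pow_mul, mul_comm w 2]; ring

/-! ### Integers with many divisors have density zero -/

theorem sum_numDivisors_le (M : ℕ) :
    ∑ n ∈ Finset.Ioc 0 M, (numDivisors n : ℝ) ≤ M * (1 + Real.log M) := by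
  have h1 : ∑ n ∈ Finset.Ioc 0 M, (numDivisors n : ℝ) =
      ∑ n ∈ Finset.Ioc 0 M, ((M / n : ℕ) : ℝ) := by
    have := ArithmeticFunction.sum_Ioc_sigma0_eq_sum_div M
    simp only [ArithmeticFunction.sigma_zero_apply] at this
    exact_mod_cast this
  rw [h1]
  calc _ ≤ ∑ n ∈ Finset.Ioc 0 M, (M : ℝ) * (n : ℝ)⁻¹ := by
        refine Finset.sum_le_sum fun n _ => ?_
        rw [← div_eq_mul_inv]; exact Nat.cast_div_le
    _ = M * (harmonic M : ℝ) := by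
        rw [← Finset.mul_sum, harmonic_eq_sum_Icc]; push_cast; rfl
    _ ≤ _ := by gcongr; exact harmonic_le_one_add_log M

/-- Markov's inequality for `τ`. The `n ≤ √M` are discarded, and for the others `log n ≥ (log M) /
2` makes the threshold uniform. -/
theorem card_large_numDivisors_le {α : ℝ} (hα : 0 < α) {M : ℕ} (hM : 2 ≤ M) :
    (({n | Real.log n ^ α ≤ numDivisors n ∧ n ≤ M} : Set ℕ).ncard : ℝ) ≤
      (Real.sqrt M + 1) + M * (1 + Real.log M) / (Real.log M / 2) ^ α := by
  classical
  have hlogM : 0 < Real.log M := Real.log_pos (by exact_mod_cast hM)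
  have hpos : 0 < (Real.log M / 2) ^ α := Real.rpow_pos_of_pos (by positivity) _
  set A : Finset ℕ := Finset.range (Nat.sqrt M + 1) with hA
  set B : Finset ℕ := (Finset.Ioc 0 M).filter
    fun n => (Real.log M / 2) ^ α ≤ (numDivisors n : ℝ) with hB
  have hsub : ({n | Real.log n ^ α ≤ numDivisors n ∧ n ≤ M} : Set ℕ) ⊆ ((A ∪ B : Finset ℕ) : Set ℕ) := by
    rintro n ⟨hn, hnM⟩
    rw [Finset.mem_coe, Finset.mem_union]
    by_cases hs : n < Nat.sqrt M + 1
    · exact Or.inl (Finset.mem_range.mpr hs)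
    · right
      have hsq : M ≤ n ^ 2 := by
        have := Nat.sqrt_lt'.mp (show Nat.sqrt M < n by omega)
        exact this.le
      rw [hB, Finset.mem_filter, Finset.mem_Ioc]
      refine ⟨⟨by omega, hnM⟩, le_trans ?_ hn⟩
      refine Real.rpow_le_rpow (by positivity) ?_ hα.le
      have : Real.log M ≤ Real.log ((n : ℝ) ^ 2) :=
        Real.log_le_log (by positivity) (by exact_mod_cast hsq)
      rw [Real.log_pow] at this
      push_cast at this
      linarith
  have hBc : (B.card : ℝ) * (Real.log M / 2) ^ α ≤ M * (1 + Real.log M) := by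
    calc _ = ∑ n ∈ B, (Real.log M / 2) ^ α := by rw [Finset.sum_const, nsmul_eq_mul]
      _ ≤ ∑ n ∈ B, (numDivisors n : ℝ) :=
        Finset.sum_le_sum fun n hn => (Finset.mem_filter.mp hn).2
      _ ≤ ∑ n ∈ Finset.Ioc 0 M, (numDivisors n : ℝ) :=
        Finset.sum_le_sum_of_subset_of_nonneg (Finset.filter_subset _ _)
          fun _ _ _ => Nat.cast_nonneg _
      _ ≤ _ := sum_numDivisors_le M
  have hcard := Set.ncard_le_ncard hsub (Finset.finite_toSet _)
  rw [Set.ncard_coe_finset] at hcard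
  calc _ ≤ ((A ∪ B).card : ℝ) := by exact_mod_cast hcard
    _ ≤ (A.card : ℝ) + B.card := by exact_mod_cast Finset.card_union_le A B
    _ ≤ _ := by
      refine add_le_add ?_ ((le_div_iff₀ hpos).mpr hBc)
      rw [hA, Finset.card_range]; push_cast
      gcongr
      exact Real.nat_sqrt_le_real_sqrt

theorem hasAsymptoticDensity_zero_of_large_numDivisors {α : ℝ} (hα : 1 < α) {E : Set ℕ}
    (hE : ∀ n ∈ E, Real.log n ^ α ≤ numDivisors n) : HasAsymptoticDensity E 0 := by
  have hlog : Tendsto (fun M : ℕ => Real.log M) atTop atTop :=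
    Real.tendsto_log_atTop.comp tendsto_natCast_atTop_atTop
  have h1 : Tendsto (fun M : ℕ => Real.sqrt M / (M : ℝ)) atTop (𝓝 0) := by
    have : Tendsto (fun M : ℕ => (Real.sqrt M)⁻¹) atTop (𝓝 0) :=
      tendsto_inv_atTop_zero.comp (Real.tendsto_sqrt_atTop.comp tendsto_natCast_atTop_atTop)
    refine this.congr fun M => ?_
    rw [Real.sqrt_div_self']; simp
  have h2 : Tendsto (fun M : ℕ => 1 / (M : ℝ)) atTop (𝓝 0) := tendsto_one_div_atTop_nhds_zero_nat
  have h3 : Tendsto (fun M : ℕ => (1 + Real.log M) / (Real.log M / 2) ^ α) atTop (𝓝 0) := by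
    have hl : Tendsto (fun x : ℝ => (2 ^ α) * (x ^ (-α) + x ^ (-(α - 1)))) atTop (𝓝 0) := by
      have := ((tendsto_rpow_neg_atTop (show 0 < α by linarith)).add
        (tendsto_rpow_neg_atTop (show 0 < α - 1 by linarith))).const_mul ((2 : ℝ) ^ α)
      simpa using this
    refine (hl.comp hlog).congr' ?_
    filter_upwards [hlog.eventually_gt_atTop 0] with M hM
    simp only [Function.comp]
    rw [Real.div_rpow hM.le (by norm_num), show -(α - 1) = 1 + -α by ring,
      Real.rpow_add hM, Real.rpow_one, Real.rpow_neg hM.le]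
    have : Real.log M ^ α ≠ 0 := (Real.rpow_pos_of_pos hM _).ne'
    field_simp
  have h4 : Tendsto (fun M : ℕ => Real.sqrt M / (M : ℝ) + 1 / (M : ℝ) +
      (1 + Real.log M) / (Real.log M / 2) ^ α) atTop (𝓝 0) := by
    simpa using (h1.add h2).add h3
  refine squeeze_zero' (Eventually.of_forall fun M => by positivity) ?_ h4
  filter_upwards [eventually_ge_atTop 2] with M hM
  have hM0 : (0 : ℝ) < M := by exact_mod_cast (by omega : 0 < M)
  rw [div_le_iff₀ hM0]
  have hfin : ({n | Real.log n ^ α ≤ numDivisors n ∧ n ≤ M} : Set ℕ).Finite :=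
    (Set.finite_Iic M).subset fun n hn => hn.2
  have hle : ({n | n ∈ E ∧ n ≤ M} : Set ℕ).ncard ≤
      ({n | Real.log n ^ α ≤ numDivisors n ∧ n ≤ M} : Set ℕ).ncard :=
    Set.ncard_le_ncard (fun n hn => ⟨hE n hn.1, hn.2⟩) hfin
  calc _ ≤ (({n | Real.log n ^ α ≤ numDivisors n ∧ n ≤ M} : Set ℕ).ncard : ℝ) := by
        exact_mod_cast hle
    _ ≤ _ := card_large_numDivisors_le (by linarith) hM
    _ = _ := by field_simp

/-- Outside a set of density zero, `𝒩(u) < 32 (log u) ^ log 8`. -/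
theorem exists_exceptional_set : ∃ E : Set ℕ, E ⊆ determinantSet ∧ HasAsymptoticDensity E 0 ∧
    ∃ C : ℝ, ∀ u ∈ determinantSet, u ∉ E → (wrCount u : ℝ) < C * Real.log u ^ Real.log 8 := by
  have hlog8 : Real.log 8 = 3 * Real.log 2 := by
    rw [show (8 : ℝ) = 2 ^ 3 by norm_num, Real.log_pow]; norm_num
  refine ⟨{u | u ∈ determinantSet ∧ 32 * Real.log u ^ Real.log 8 ≤ wrCount u}, fun u hu => hu.1,
    hasAsymptoticDensity_zero_of_large_numDivisors (α := Real.log 8 / 2) ?_ ?_, 32, ?_⟩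
  -- `log 8 / 2 = (3 / 2) log 2 > 1`, which is what the density argument requires.
  · have := Real.log_two_gt_d9
    rw [hlog8]; linarith
  · rintro u ⟨-, hu⟩
    -- At `u = 0` the left side is a positive power of `Real.log 0 = 0`, hence `0`.
    rcases Nat.eq_zero_or_pos u with rfl | hpos
    · have : Real.log 8 / 2 ≠ 0 := by
        have := Real.log_two_gt_d9
        rw [hlog8]; linarith
      simp [Real.zero_rpow this]
    · have h1 : (wrCount u : ℝ) ≤ 32 * (numDivisors u : ℝ) ^ 2 := by exact_mod_cast wrCount_le hpos
      have hl : 0 ≤ Real.log u := Real.log_natCast_nonneg u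
      refine le_of_sq_le_sq ?_ (Nat.cast_nonneg _)
      rw [← Real.rpow_natCast, ← Real.rpow_mul hl]
      have : Real.log 8 / 2 * ((2 : ℕ) : ℝ) = Real.log 8 := by push_cast; ring
      rw [this]
      linarith
  · intro u hu hE
    by_contra! hcon
    exact hE ⟨hu, hcon⟩

/-! ### A Chebyshev bound for primes congruent to 1 modulo 4 -/

theorem card_le_div_add_one {A : Finset ℕ} {N q : ℕ} (hA : ∀ n ∈ A, n ≤ N)
    (h : ∀ m ∈ A, ∀ n ∈ A, m ≡ n [MOD q]) : A.card ≤ N / q + 1 := by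
  rw [← Finset.card_range (N / q + 1)]
  refine Finset.card_le_card_of_injOn (fun n => n / q) (fun n hn => ?_) ?_
  · exact Finset.mem_coe.mpr (Finset.mem_range.mpr (Nat.lt_succ_of_le (Nat.div_le_div_right (hA n hn))))
  · intro m hm n hn hmn
    have h1 := Nat.div_add_mod m q
    have h2 := Nat.div_add_mod n q
    have h3 : m % q = n % q := h m hm n hn
    simp only at hmn
    rw [← h1, ← h2, hmn, h3]

/-- The two values differ by `4 (m - n)(m + n)`. A prime dividing both `m - n` and `m + n` would
divide `2m`, which is impossible for an odd `p` dividing `4m² + 1`. -/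
theorem pow_dvd_sub_or_add_of_root {p j m n : ℕ} (hp : p.Prime) (h2 : p ≠ 2) (hj : j ≠ 0)
    (hm : p ^ j ∣ 4 * m ^ 2 + 1) (hn : p ^ j ∣ 4 * n ^ 2 + 1) :
    ((p ^ j : ℕ) : ℤ) ∣ (m : ℤ) - n ∨ ((p ^ j : ℕ) : ℤ) ∣ (m : ℤ) + n := by
  have hpz : Prime (p : ℤ) := Nat.prime_iff_prime_int.mp hp
  have hm' : (p : ℤ) ^ j ∣ 4 * (m : ℤ) ^ 2 + 1 := by exact_mod_cast hm
  have hn' : (p : ℤ) ^ j ∣ 4 * (n : ℤ) ^ 2 + 1 := by exact_mod_cast hn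
  have hp2 : ¬ (p : ℤ) ∣ 2 := fun h => h2 <|
    (Nat.prime_dvd_prime_iff_eq hp Nat.prime_two).mp (by exact_mod_cast h)
  have hpm : ¬ (p : ℤ) ∣ m := fun h => by
    have h3 : (p : ℤ) ∣ 4 * (m : ℤ) ^ 2 + 1 := (dvd_pow_self _ hj).trans hm'
    have h4 : (p : ℤ) ∣ 4 * (m : ℤ) ^ 2 := (dvd_pow h two_ne_zero).mul_left 4
    exact hpz.not_isUnit (isUnit_of_dvd_one ((dvd_add_right h4).mp h3))
  have hcop4 : IsCoprime ((p : ℤ) ^ j) 4 := by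
    have h4 : IsCoprime ((p : ℤ)) 2 := (Prime.coprime_iff_not_dvd hpz).mpr hp2
    exact (h4.pow (m := j) (n := 2))
  have hprod : (p : ℤ) ^ j ∣ ((m : ℤ) - n) * (m + n) := by
    refine hcop4.dvd_of_dvd_mul_left ?_
    have := dvd_sub hm' hn'
    rwa [show 4 * (m : ℤ) ^ 2 + 1 - (4 * (n : ℤ) ^ 2 + 1) = 4 * (((m : ℤ) - n) * (m + n)) by ring]
      at this
  push_cast
  by_cases hd : (p : ℤ) ∣ (m : ℤ) - n
  · left
    refine (IsCoprime.pow_left ((Prime.coprime_iff_not_dvd hpz).mpr fun h' => ?_)).dvd_of_dvd_mul_right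
      hprod
    have h5 := dvd_add hd h'
    rw [show (m : ℤ) - n + (m + n) = 2 * m by ring] at h5
    exact (hpz.dvd_or_dvd h5).elim hp2 hpm
  · right
    exact (IsCoprime.pow_left ((Prime.coprime_iff_not_dvd hpz).mpr hd)).dvd_of_dvd_mul_left hprod

theorem card_roots_le {p : ℕ} (hp : p.Prime) (h2 : p ≠ 2) {j : ℕ} (hj : j ≠ 0) (N : ℕ) :
    ((Finset.Icc 1 N).filter fun n => p ^ j ∣ 4 * n ^ 2 + 1).card ≤ 2 * (N / p ^ j + 1) := by
  classical
  set R := (Finset.Icc 1 N).filter fun n => p ^ j ∣ 4 * n ^ 2 + 1 with hR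
  rcases R.eq_empty_or_nonempty with he | ⟨m, hm⟩
  · rw [he]; simp
  have hmR := (Finset.mem_filter.mp hm).2
  have hsub : R ⊆ R.filter (fun n => ((p ^ j : ℕ) : ℤ) ∣ (m : ℤ) - (n : ℕ)) ∪
      R.filter (fun n => ((p ^ j : ℕ) : ℤ) ∣ (m : ℤ) + (n : ℕ)) := by
    intro n hn
    rw [Finset.mem_union, Finset.mem_filter (s := R), Finset.mem_filter (s := R)]
    rcases pow_dvd_sub_or_add_of_root hp h2 hj hmR (Finset.mem_filter.mp hn).2 with h | h
    · exact Or.inl ⟨hn, h⟩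
    · exact Or.inr ⟨hn, h⟩
  have hle : ∀ n ∈ R, n ≤ N := fun n hn =>
    (Finset.mem_Icc.mp (Finset.mem_filter.mp hn).1).2
  have c1 : (R.filter (fun n => ((p ^ j : ℕ) : ℤ) ∣ (m : ℤ) - (n : ℕ))).card ≤ N / p ^ j + 1 := by
    refine card_le_div_add_one (fun n hn => hle n (Finset.mem_filter.mp hn).1) ?_
    intro a ha b hb
    rw [Nat.modEq_iff_dvd]
    have := dvd_sub (Finset.mem_filter.mp ha).2 (Finset.mem_filter.mp hb).2
    rwa [show (m : ℤ) - a - (m - b) = b - a by ring] at this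
  have c2 : (R.filter (fun n => ((p ^ j : ℕ) : ℤ) ∣ (m : ℤ) + (n : ℕ))).card ≤ N / p ^ j + 1 := by
    refine card_le_div_add_one (fun n hn => hle n (Finset.mem_filter.mp hn).1) ?_
    intro a ha b hb
    rw [Nat.modEq_iff_dvd]
    have := dvd_sub (Finset.mem_filter.mp hb).2 (Finset.mem_filter.mp ha).2
    rwa [show (m : ℤ) + b - (m + a) = b - a by ring] at this
  have := (Finset.card_le_card hsub).trans (Finset.card_union_le _ _)
  omega

/-- Legendre's count: sum over `j` the number of `n ≤ N` with `p ^ j ∣ 4n² + 1`. Two residue classes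
give at most `2 (N / p ^ j + 1)`; the quotients add up to the exponent of `p` in `N!`, and the extra
`1` is paid for each `j` up to the logarithm. -/
theorem factorization_prod_le {p : ℕ} (hp : p.Prime) (h2 : p ≠ 2) (N : ℕ) :
    (∏ n ∈ Finset.Icc 1 N, (4 * n ^ 2 + 1)).factorization p ≤
      2 * N.factorial.factorization p + 2 * Nat.log p (4 * N ^ 2 + 1) := by
  classical
  have := Fact.mk hp
  set L := Nat.log p (4 * N ^ 2 + 1) with hL
  have hv : ∀ n ∈ Finset.Icc 1 N, (4 * n ^ 2 + 1).factorization p ≤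
      ((Finset.Ico 1 (L + 1)).filter fun j => p ^ j ∣ 4 * n ^ 2 + 1).card := by
    intro n hn
    set v := (4 * n ^ 2 + 1).factorization p with hv
    have hvd : p ^ v ∣ 4 * n ^ 2 + 1 := Nat.ordProj_dvd _ _
    have hvL : v ≤ L := by
      refine Nat.le_log_of_pow_le hp.one_lt ((Nat.le_of_dvd (by positivity) hvd).trans ?_)
      have := (Finset.mem_Icc.mp hn).2
      gcongr
    calc v = (Finset.Ico 1 (v + 1)).card := by simp
      _ ≤ _ := Finset.card_le_card fun j hj => by
        rw [Finset.mem_Ico] at hj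
        rw [Finset.mem_filter, Finset.mem_Ico]
        exact ⟨⟨hj.1, by omega⟩, (pow_dvd_pow p (by omega)).trans hvd⟩
  have hfact : N.factorial.factorization p = ∑ j ∈ Finset.Ico 1 (L + 1), N / p ^ j := by
    rw [Nat.factorization_def _ hp]
    refine padicValNat_factorial (Nat.lt_succ_of_le (Nat.log_mono_right ?_))
    nlinarith
  rw [Nat.factorization_prod (fun n _ => by positivity), Finsupp.finsetSum_apply]
  calc _ ≤ ∑ n ∈ Finset.Icc 1 N,
        ((Finset.Ico 1 (L + 1)).filter fun j => p ^ j ∣ 4 * n ^ 2 + 1).card :=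
        Finset.sum_le_sum hv
    _ = ∑ j ∈ Finset.Ico 1 (L + 1),
        ((Finset.Icc 1 N).filter fun n => p ^ j ∣ 4 * n ^ 2 + 1).card :=
        Finset.sum_card_bipartiteAbove_eq_sum_card_bipartiteBelow _
    _ ≤ ∑ j ∈ Finset.Ico 1 (L + 1), 2 * (N / p ^ j + 1) :=
        Finset.sum_le_sum fun j hj =>
          card_roots_le hp h2 (by have := (Finset.mem_Ico.mp hj).1; omega) N
    _ = _ := by
        rw [hfact, ← Finset.mul_sum, Finset.sum_add_distrib, mul_add]; simp

theorem prime_mod_four_of_dvd {p n : ℕ} (hp : p.Prime) (h : p ∣ 4 * n ^ 2 + 1) : p % 4 = 1 := by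
  have := Fact.mk hp
  have h2 : p ≠ 2 := by
    rintro rfl
    omega
  have h3 : p % 4 ≠ 3 := by
    apply ZMod.mod_four_ne_three_of_sq_eq_neg_one (y := ((2 * n : ℕ) : ZMod p))
    have : ((4 * n ^ 2 + 1 : ℕ) : ZMod p) = 0 := (ZMod.natCast_eq_zero_iff _ _).mpr h
    push_cast at this ⊢
    linear_combination this
  have := hp.eq_two_or_odd
  omega

/-- Being a prime congruent to `1` modulo `4`. -/
def PrimeOneModFour (p : ℕ) : Prop := p.Prime ∧ p % 4 = 1

noncomputable instance : DecidablePred PrimeOneModFour := Classical.decPred _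

/-- A Chebyshev-type lower bound for the number of primes `≡ 1 (mod 4)` up to `4N² + 1`. -/
theorem four_pow_le_pow_count (N : ℕ) :
    4 ^ N ≤ (4 * N ^ 2 + 1) ^ (2 * Nat.count PrimeOneModFour (4 * N ^ 2 + 2)) := by
  classical
  set Q := ∏ n ∈ Finset.Icc 1 N, (4 * n ^ 2 + 1) with hQ
  set S := (Finset.range (4 * N ^ 2 + 2)).filter PrimeOneModFour with hS
  have hQ0 : Q ≠ 0 := Finset.prod_ne_zero_iff.mpr fun n _ => by positivity
  have hlow : 4 ^ N * N.factorial ^ 2 ≤ Q := by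
    have : ∀ N : ℕ, 4 ^ N * N.factorial ^ 2 = ∏ n ∈ Finset.Icc 1 N, (4 * n ^ 2) := by
      intro N
      induction N with
      | zero => simp
      | succ k ih =>
        rw [Finset.prod_Icc_succ_top (by omega), ← ih, Nat.factorial_succ]
        ring
    rw [this]
    exact Finset.prod_le_prod' fun n _ => Nat.le_succ _
  have hsub : Q.primeFactors ⊆ S := by
    intro p hp
    have hpp := Nat.prime_of_mem_primeFactors hp
    obtain ⟨n, hn, hpn⟩ := (hpp.prime.dvd_finsetProd_iff _).mp (Nat.dvd_of_mem_primeFactors hp)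
    rw [hS, Finset.mem_filter, Finset.mem_range]
    refine ⟨?_, hpp, prime_mod_four_of_dvd hpp hpn⟩
    have h1 := Nat.le_of_dvd (by positivity) hpn
    have h2 : 4 * n ^ 2 + 1 ≤ 4 * N ^ 2 + 1 := by
      have := (Finset.mem_Icc.mp hn).2
      gcongr
    omega
  have hfac : ∏ p ∈ S, p ^ N.factorial.factorization p ≤ N.factorial := by
    calc _ ≤ ∏ p ∈ S ∪ N.factorial.primeFactors, p ^ N.factorial.factorization p := by
          refine Finset.prod_le_prod_of_subset_of_one_le' Finset.subset_union_left ?_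
          intro p hp _
          refine Nat.one_le_pow _ _ ?_
          rcases Finset.mem_union.mp hp with h | h
          · exact (Finset.mem_filter.mp h).2.1.pos
          · exact (Nat.prime_of_mem_primeFactors h).pos
      _ = N.factorial := by
          conv_rhs => rw [← Nat.prod_factorization_pow_eq_self (Nat.factorial_ne_zero N)]
          exact (Finsupp.prod_of_support_subset _ (by simp) _ (by simp)).symm
  -- The factor `(N!)²` matches the one in `hlow` and cancels, leaving `4 ^ N` against one factor
  -- `(4N² + 1)²` per prime of `S`.
  have hup : Q ≤ N.factorial ^ 2 * (4 * N ^ 2 + 1) ^ (2 * S.card) := by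
    calc Q = ∏ p ∈ S, p ^ Q.factorization p := by
          conv_lhs => rw [← Nat.prod_factorization_pow_eq_self hQ0]
          exact Finsupp.prod_of_support_subset _ (by simpa using hsub) _ (by simp)
      _ ≤ ∏ p ∈ S, (p ^ N.factorial.factorization p) ^ 2 * (4 * N ^ 2 + 1) ^ 2 := by
          refine Finset.prod_le_prod' fun p hp => ?_
          obtain ⟨hpp, hp4⟩ := (Finset.mem_filter.mp hp).2
          calc p ^ Q.factorization p ≤ p ^ (2 * N.factorial.factorization p +
                2 * Nat.log p (4 * N ^ 2 + 1)) :=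
                Nat.pow_le_pow_right hpp.pos (factorization_prod_le hpp (by omega) N)
            _ = (p ^ N.factorial.factorization p) ^ 2 *
                (p ^ Nat.log p (4 * N ^ 2 + 1)) ^ 2 := by
                rw [pow_add, ← pow_mul, ← pow_mul, mul_comm 2, mul_comm 2]
            _ ≤ _ := by
                gcongr
                exact Nat.pow_log_le_self p (by positivity)
      _ = (∏ p ∈ S, p ^ N.factorial.factorization p) ^ 2 *
          (4 * N ^ 2 + 1) ^ (2 * S.card) := by
          rw [Finset.prod_mul_distrib, Finset.prod_pow, Finset.prod_const, ← pow_mul]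
      _ ≤ _ := by gcongr
  have hcard : S.card = Nat.count PrimeOneModFour (4 * N ^ 2 + 2) := by
    rw [Nat.count_eq_card_filter_range]
  rw [← hcard]
  have h := hlow.trans hup
  rw [mul_comm] at h
  exact Nat.le_of_mul_le_mul_left h (pow_pos (Nat.factorial_pos N) 2)

theorem infinite_primeOneModFour : (Set.ofPred PrimeOneModFour).Infinite := by
  rw [Set.infinite_iff_exists_gt]
  intro n
  obtain ⟨p, hp, hn, h⟩ := Nat.exists_prime_gt_modEq_one (k := 4) n (by norm_num)
  exact ⟨p, ⟨hp, h⟩, hn⟩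

/-- Only logarithms of these primes enter later, so any polynomial bound suffices. -/
theorem nth_primeOneModFour_le (j : ℕ) :
    Nat.nth PrimeOneModFour j ≤ 1025 * (j + 1) ^ 4 := by
  set m := j + 1 with hm
  have hm1 : 1 ≤ m := by omega
  -- Chosen so that `4 ^ N = (2 ^ (16 * m)) ^ (2 * m)`, while `4N² + 1 < 2 ^ (16 * m)`; having at
  -- most `m` primes would contradict `four_pow_le_pow_count`.
  set N := 16 * m ^ 2 with hN
  have hb : 4 * N ^ 2 + 1 ≤ 1025 * m ^ 4 := by
    have := Nat.one_le_pow 4 m hm1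
    rw [hN]; ring_nf; ring_nf at this; omega
  have hb2 : 1025 * m ^ 4 < 2 ^ (16 * m) := by
    have h1 : m ^ 4 < (2 ^ m) ^ 4 := Nat.pow_lt_pow_left (Nat.lt_two_pow_self) (by norm_num)
    have h2 : 2 ^ 12 ≤ 2 ^ (12 * m) := Nat.pow_le_pow_right (by norm_num) (by omega)
    calc 1025 * m ^ 4 < 1025 * (2 ^ m) ^ 4 := by omega
      _ ≤ 2 ^ (12 * m) * (2 ^ m) ^ 4 := Nat.mul_le_mul_right _ (by omega)
      _ = _ := by rw [← pow_mul, ← pow_add]; congr 1; ring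
  have hcount : j < Nat.count PrimeOneModFour (4 * N ^ 2 + 2) := by
    by_contra! hcon
    have h1 := four_pow_le_pow_count N
    have h2 : (4 * N ^ 2 + 1) ^ (2 * Nat.count PrimeOneModFour (4 * N ^ 2 + 2)) ≤
        (4 * N ^ 2 + 1) ^ (2 * m) := Nat.pow_le_pow_right (by positivity) (by omega)
    have h3 : (4 * N ^ 2 + 1) ^ (2 * m) < (2 ^ (16 * m)) ^ (2 * m) :=
      Nat.pow_lt_pow_left (hb.trans_lt hb2) (by omega)
    have h4 : (2 ^ (16 * m)) ^ (2 * m) = 4 ^ N := by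
      rw [show 4 = 2 ^ 2 by norm_num, ← pow_mul, ← pow_mul, hN]; congr 1; ring
    omega
  have := Nat.nth_lt_of_lt_count hcount
  omega

/-! ### The extremal sequence -/

/-- The first `t` primes congruent to `1` modulo `4`. -/
noncomputable def firstPrimes (t : ℕ) : Finset ℕ :=
  (Finset.range t).image (Nat.nth PrimeOneModFour)

theorem mem_firstPrimes {t p : ℕ} (hp : p ∈ firstPrimes t) : p.Prime ∧ p % 4 = 1 := by
  obtain ⟨j, -, rfl⟩ := Finset.mem_image.mp hp
  exact Nat.nth_mem_of_infinite infinite_primeOneModFour j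

theorem card_firstPrimes (t : ℕ) : (firstPrimes t).card = t := by
  rw [firstPrimes, Finset.card_image_of_injective _ (Nat.nth_injective infinite_primeOneModFour),
    Finset.card_range]

theorem le_of_mem_firstPrimes {t p : ℕ} (hp : p ∈ firstPrimes t) : p ≤ 1025 * t ^ 4 := by
  obtain ⟨j, hj, rfl⟩ := Finset.mem_image.mp hp
  have : j + 1 ≤ t := Finset.mem_range.mp hj
  exact (nth_primeOneModFour_le j).trans (by gcongr)

theorem prod_firstPrimes_sq_strictMono :
    StrictMono fun t : ℕ => ∏ p ∈ firstPrimes t, p ^ 2 := by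
  have h : ∀ t, ∏ p ∈ firstPrimes t, p ^ 2 =
      ∏ j ∈ Finset.range t, Nat.nth PrimeOneModFour j ^ 2 := fun t =>
    Finset.prod_image fun _ _ _ _ h => Nat.nth_injective infinite_primeOneModFour h
  refine strictMono_nat_of_lt_succ fun t => ?_
  simp only [h]
  rw [Finset.prod_range_succ]
  have hq : ∀ j, 1 < Nat.nth PrimeOneModFour j := fun j =>
    (Nat.nth_mem_of_infinite infinite_primeOneModFour j).1.one_lt
  exact lt_mul_of_one_lt_right
    (Finset.prod_pos fun j _ => pow_pos (zero_lt_one.trans (hq j)) 2)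
    (Nat.one_lt_pow two_ne_zero (hq t))

theorem log_prod_firstPrimes_sq_le {t : ℕ} (ht : 0 < t) :
    Real.log ((∏ p ∈ firstPrimes t, p ^ 2 : ℕ) : ℝ) ≤ 2 * t * (8 + 4 * Real.log t) := by
  have htr : (0 : ℝ) < t := by exact_mod_cast ht
  have h1 : ∏ p ∈ firstPrimes t, p ^ 2 ≤ ((1025 * t ^ 4) ^ 2) ^ t := by
    calc _ ≤ ∏ p ∈ firstPrimes t, (1025 * t ^ 4) ^ 2 :=
          Finset.prod_le_prod' fun p hp => Nat.pow_le_pow_left (le_of_mem_firstPrimes hp) 2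
      _ = _ := by rw [Finset.prod_const, card_firstPrimes]
  have hpos : 0 < ∏ p ∈ firstPrimes t, p ^ 2 :=
    Finset.prod_pos fun p hp => pow_pos (mem_firstPrimes hp).1.pos 2
  have h8 : Real.log 1025 ≤ 8 := by
    have : Real.log 1025 ≤ Real.log (2 ^ 11) := Real.log_le_log (by norm_num) (by norm_num)
    rw [Real.log_pow] at this
    have := Real.log_two_lt_d9
    push_cast at *
    linarith
  calc _ ≤ Real.log ((((1025 * t ^ 4) ^ 2) ^ t : ℕ) : ℝ) :=
        Real.log_le_log (by exact_mod_cast hpos) (by exact_mod_cast h1)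
    _ = 2 * t * (Real.log 1025 + 4 * Real.log t) := by
        push_cast
        rw [Real.log_pow, Real.log_pow, Real.log_mul (by norm_num) (by positivity), Real.log_pow]
        push_cast; ring
    _ ≤ _ := by gcongr

theorem cardDistinctFactors_prod_firstPrimes_sq (t : ℕ) :
    ArithmeticFunction.cardDistinctFactors (∏ p ∈ firstPrimes t, p ^ 2) = t := by
  rw [ArithmeticFunction.cardDistinctFactors_prod]
  · rw [Finset.sum_congr rfl fun p hp =>
      ArithmeticFunction.cardDistinctFactors_apply_prime_pow (mem_firstPrimes hp).1 two_ne_zero]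
    simp [card_firstPrimes]
  · intro p hp q hq hpq
    exact Nat.Coprime.pow _ _
      ((Nat.coprime_primes (mem_firstPrimes hp).1 (mem_firstPrimes hq).1).mpr hpq)

/-- The number of primes in the `k`-th term of the extremal sequence. -/
def numPrimes (k : ℕ) : ℕ := 32 * k * (Nat.log 2 k + 1)

theorem numPrimes_pos {k : ℕ} (hk : 1 ≤ k) : 0 < numPrimes k := by
  unfold numPrimes; positivity

theorem numPrimes_strictMono : StrictMono numPrimes := by
  intro a b hab
  have h : Nat.log 2 a ≤ Nat.log 2 b := Nat.log_mono_right hab.le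
  unfold numPrimes
  exact Nat.mul_lt_mul_of_lt_of_le (by omega) (by omega) (by omega)

/-- With `L = Nat.log 2 k + 1`, both `k` and `L` are at most `2 ^ L`. So the number `t` of primes is
at most `2 ^ (5 + 2L)`, and `log u ≤ 24 t² ≤ 2 ^ (15 + 4L) ≤ 2 ^ (32L)`. The `k`-th power of the
last bound is exactly `2 ^ t`. -/
theorem log_pow_le_two_pow_numPrimes {k : ℕ} (hk : 1 ≤ k) :
    Real.log ((∏ p ∈ firstPrimes (numPrimes k), p ^ 2 : ℕ) : ℝ) ^ k ≤ 2 ^ numPrimes k := by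
  have htr : (0 : ℝ) < numPrimes k := by exact_mod_cast numPrimes_pos hk
  set L := Nat.log 2 k + 1 with hL
  have hkL : k ≤ 2 ^ L := (Nat.lt_pow_succ_log_self (by norm_num) k).le
  have hLL : L ≤ 2 ^ L := Nat.lt_two_pow_self.le
  have ht : numPrimes k ≤ 2 ^ 5 * (2 ^ L) ^ 2 := by
    rw [numPrimes, ← hL]
    calc 32 * k * L ≤ 32 * 2 ^ L * 2 ^ L := by gcongr
      _ = _ := by ring
  have hlogt : Real.log (numPrimes k) ≤ numPrimes k := by
    linarith [Real.log_le_sub_one_of_pos htr]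
  have h1 : (1 : ℝ) ≤ numPrimes k := by exact_mod_cast numPrimes_pos hk
  have hlog : Real.log ((∏ p ∈ firstPrimes (numPrimes k), p ^ 2 : ℕ) : ℝ) ≤ 2 ^ (32 * L) := by
    calc _ ≤ 2 * (numPrimes k : ℝ) * (8 + 4 * Real.log (numPrimes k)) :=
          log_prod_firstPrimes_sq_le (numPrimes_pos hk)
      _ ≤ 2 * (numPrimes k : ℝ) * (8 * numPrimes k + 4 * numPrimes k) := by gcongr; linarith
      _ = 24 * (numPrimes k : ℝ) ^ 2 := by ring
      _ ≤ 24 * (2 ^ 5 * (2 ^ L) ^ 2) ^ 2 := by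
          gcongr; exact_mod_cast ht
      _ ≤ 2 ^ 15 * 2 ^ (4 * L) := by
          rw [show ((2 : ℝ) ^ 5 * (2 ^ L) ^ 2) ^ 2 = 2 ^ 10 * 2 ^ (4 * L) by
            rw [mul_pow, ← pow_mul, ← pow_mul, ← pow_mul]; ring_nf]
          have : (0 : ℝ) < 2 ^ (4 * L) := by positivity
          nlinarith
      _ = 2 ^ (15 + 4 * L) := (pow_add _ _ _).symm
      _ ≤ _ := pow_le_pow_right₀ (by norm_num) (by omega)
  calc _ ≤ ((2 : ℝ) ^ (32 * L)) ^ k :=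
        pow_le_pow_left₀ (Real.log_natCast_nonneg _) hlog k
    _ = _ := by rw [← pow_mul, numPrimes, ← hL]; congr 1; ring

theorem numPrimes_le {k : ℕ} (hk : 2 ≤ k) : (numPrimes k : ℝ) ≤ 96 * (k * Real.log k) := by
  have hk0 : (0 : ℝ) < k := by exact_mod_cast (by omega : 0 < k)
  have h2 := Real.log_two_gt_d9
  have hl : Real.log 2 ≤ Real.log k := Real.log_le_log (by norm_num) (by exact_mod_cast hk)
  have hpow : (Nat.log 2 k : ℝ) * Real.log 2 ≤ Real.log k := by
    rw [← Real.log_pow]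
    exact Real.log_le_log (by positivity) (by exact_mod_cast Nat.pow_log_le_self 2 (by omega))
  -- Each summand is at most `log k / log 2`, and `2 / log 2 < 3`.
  have hL : (Nat.log 2 k : ℝ) + 1 ≤ 3 * Real.log k := by
    have : (0 : ℝ) ≤ Nat.log 2 k := Nat.cast_nonneg _
    nlinarith
  unfold numPrimes
  push_cast
  nlinarith

theorem log_prod_firstPrimes_numPrimes_le {k : ℕ} (hk : 2 ≤ k) :
    Real.log ((∏ p ∈ firstPrimes (numPrimes k), p ^ 2 : ℕ) : ℝ) ≤
      7680 * (k * Real.log k ^ 2) := by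
  have hk0 : (0 : ℝ) < k := by exact_mod_cast (by omega : 0 < k)
  have h2 := Real.log_two_gt_d9
  have h2' := Real.log_two_lt_d9
  have hl : Real.log 2 ≤ Real.log k := Real.log_le_log (by norm_num) (by exact_mod_cast hk)
  have hlt : Real.log (numPrimes k) ≤ 7 * Real.log k := by
    have h1 : numPrimes k ≤ 2 ^ 5 * k ^ 2 := by
      have : Nat.log 2 k + 1 ≤ k := Nat.log_lt_self 2 (by omega)
      calc numPrimes k = 32 * k * (Nat.log 2 k + 1) := rfl
        _ ≤ 32 * k * k := by gcongr
        _ = _ := by ring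
    have h3 : Real.log (numPrimes k) ≤ Real.log (2 ^ 5 * (k : ℝ) ^ 2) :=
      Real.log_le_log (by exact_mod_cast numPrimes_pos (by omega)) (by exact_mod_cast h1)
    rw [Real.log_mul (by norm_num) (by positivity), Real.log_pow, Real.log_pow] at h3
    push_cast at h3
    linarith
  calc _ ≤ 2 * (numPrimes k : ℝ) * (8 + 4 * Real.log (numPrimes k)) :=
        log_prod_firstPrimes_sq_le (numPrimes_pos (by omega))
    -- `8 + 28 log k ≤ 40 log k`, because `12 log 2 > 8`.
    _ ≤ 2 * (numPrimes k : ℝ) * (40 * Real.log k) := by gcongr; linarith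
    _ ≤ 2 * (96 * (k * Real.log k)) * (40 * Real.log k) := by
        have : 0 ≤ Real.log k := by linarith
        gcongr
        exact numPrimes_le hk
    _ = _ := by ring

theorem mainTheorem6 :
    (∀ u : ℕ, 0 < u → (wrLatticesOfDet u).Finite) ∧
    (∃ C : ℝ, ∀ u : ℕ, 0 < u →
      (wrCount u : ℝ) ≤
        C * ((numDivisors u : ℝ) ^ 2 * 2 ^ ArithmeticFunction.cardDistinctFactors u)) ∧
    (∃ C : ℝ, ∀ u : ℕ, 0 < u →
      (numDivisors u : ℝ) ^ 2 * 2 ^ ArithmeticFunction.cardDistinctFactors u ≤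
        C * (Real.sqrt 2 * Real.log u / (ArithmeticFunction.cardDistinctFactors u : ℝ)) ^
          (2 * ArithmeticFunction.cardDistinctFactors u)) ∧
    (∃ E : Set ℕ, E ⊆ determinantSet ∧ HasAsymptoticDensity E 0 ∧
      ∃ C : ℝ, ∀ u ∈ determinantSet, u ∉ E →
        (wrCount u : ℝ) < C * Real.log u ^ Real.log 8) ∧
    (∃ u : ℕ → ℕ, StrictMonoOn u (Set.Ici 1) ∧
      (∀ k : ℕ, 1 ≤ k →
        u k ∈ determinantSet ∧
        (∃ S : Finset ℕ, S.Nonempty ∧ (∀ p ∈ S, p.Prime ∧ p % 4 = 1) ∧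
          u k = ∏ p ∈ S, p ^ 2) ∧
        Real.log (u k) ^ k ≤ (wrCount (u k) : ℝ)) ∧
      ∃ C : ℝ, ∀ k : ℕ, 2 ≤ k →
        (u k : ℝ) ≤ Real.exp (C * (k * Real.log k ^ 2)) ∧
        (ArithmeticFunction.cardDistinctFactors (u k) : ℝ) ≤ C * (k * Real.log k)) := by
  refine ⟨fun u hu => finite_wrLatticesOfDet hu, ⟨32, fun u hu => ?_⟩,
    ⟨3 ^ 22, fun u hu => numDivisors_sq_mul_two_pow_le hu⟩, exists_exceptional_set,
    fun k => ∏ p ∈ firstPrimes (numPrimes k), p ^ 2,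
    fun a _ b _ hab => prod_firstPrimes_sq_strictMono (numPrimes_strictMono hab),
    fun k hk => ⟨(two_pow_card_le_wrCount fun p hp => mem_firstPrimes hp).2,
      ⟨firstPrimes (numPrimes k), ?_, fun p hp => mem_firstPrimes hp, rfl⟩, ?_⟩,
    -- `7680 = 2 * 96 * 40` comes from the bound on `log u`; it also exceeds the `96` needed for
    -- `ω`.
    7680, fun k hk => ⟨?_, ?_⟩⟩
  · have h1 : (wrCount u : ℝ) ≤ 32 * (numDivisors u : ℝ) ^ 2 := by exact_mod_cast wrCount_le hu
    have h2 : (1 : ℝ) ≤ 2 ^ ArithmeticFunction.cardDistinctFactors u :=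
      one_le_pow₀ (by norm_num)
    refine h1.trans ?_
    gcongr
    exact le_mul_of_one_le_right (by positivity) h2
  · rw [← Finset.card_pos, card_firstPrimes]
    exact numPrimes_pos hk
  · have h := (two_pow_card_le_wrCount fun p (hp : p ∈ firstPrimes (numPrimes k)) =>
      mem_firstPrimes hp).1
    rw [card_firstPrimes] at h
    exact (log_pow_le_two_pow_numPrimes hk).trans (by exact_mod_cast h)
  · have hpos : 0 < ∏ p ∈ firstPrimes (numPrimes k), p ^ 2 :=
      Finset.prod_pos fun p hp => pow_pos (mem_firstPrimes hp).1.pos 2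
    rw [← Real.log_le_iff_le_exp (by exact_mod_cast hpos)]
    exact log_prod_firstPrimes_numPrimes_le hk
  · rw [cardDistinctFactors_prod_firstPrimes_sq]
    have h : (0 : ℝ) ≤ k * Real.log k := mul_nonneg (Nat.cast_nonneg _) (Real.log_natCast_nonneg k)
    linarith [numPrimes_le hk]
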